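/- Let $\Omega=(a,b)\subset\mathbb R$ with $a<b$, let $T>0$, $\beta\in\mathbb R$, $\sigma>0$, and let $V\in L^\infty(\Omega)$ be real-valued. For an integer $m\ge 1$ put $H^m_{\rm per}(\Omega)=\{\phi\in H^m(\Omega):\phi^{(k)}(a)=\phi^{(k)}(b),\ k=0,\dots,m-1\}$, and put $B(v)=Vv+\beta|v|^{2\sigma}v$. Let $\psi\in C([0,T];H^2_{\rm per}(\Omega))\cap C^1([0,T];L^2(\Omega))$ be a solution of the nonlinear Schrödinger equation $$i\,\partial_t\psi=-\partial_{xx}\psi+B(\psi)\quad\text{on }\Omega\times(0,T],\qquad \psi(\cdot,0)=\psi_0 .$$ For an even integer $N\ge 2$ let $h=(b-a)/N$, $\mathcal T_N=\{-N/2,\dots,N/2-1\}$, $\mu_l=2\pi l/(b-a)$, $X_N=\operatorname{span}\{e^{i\mu_l(x-a)}:l\in\mathcal T_N\}$ and $\widehat u_l=\frac1{b-a}\int_a^b u(x)e^{-i\mu_l(x-a)}\,dx$. For a time step $\tau>0$ let $t_n=n\tau$, and let $\psi_h^n\in X_N$ $(n\ge0)$ be the sEWI-FS numerical solution, defined for $l\in\mathcal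 T_N$ by $$\widehat{(\psi_h^0)}_l=\widehat{(\psi_0)}_l,\qquad \widehat{(\psi_h^1)}_l=e^{-i\tau\mu_l^2}\widehat{(\psi_h^0)}_l-i\tau\varphi_1(-i\tau\mu_l^2)\widehat{(B(\psi_h^0))}_l,$$ $$\widehat{(\psi_h^{n+1})}_l=e^{-2i\tau\mu_l^2}\widehat{(\psi_h^{n-1})}_l-2i\tau e^{-i\tau\mu_l^2}\varphi_s(\tau\mu_l^2)\widehat{(B(\psi_h^n))}_l\quad(n\ge1),$$ where $\varphi_1(z)=(e^z-1)/z$ and $\varphi_s(\theta)=\sin(\theta)/\theta$, with $\varphi_1(0)=\varphi_s(0)=1$. Then there exist $\tau_0>0$, $h_0>0$ and a constant $C>0$, independent of $\tau$, $h$ and $n$, such that whenever $0<\tau<\tau_0$ and $0<h<h_0$, for all integers $n$ with $0\le n\le T/\tau$, $$\|\psi(\cdot,t_n)-\psi_h^n\|_{L^2}\le C(\tau+h^2),\qquad \|\psi_h^n\|_{H^2}\le C,\qquad \|\psi(\cdot,t_n)-\psi_h^n\|_{H^1}\le C(\tau^{1/2}+h).$$ -/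

import Mathlib

open MeasureTheory Set Filter
open scoped ENNReal ContDiff

noncomputable section

/-- Lebesgue measure on the interval `Ω = (a, b)`. -/
abbrev volOn (a b : ℝ) : Measure ℝ := volume.restrict (Ioo a b)

/-- The complex Hilbert space `L²(Ω)`, `Ω = (a, b)`. -/
abbrev L2 (a b : ℝ) : Type := Lp ℂ 2 (volOn a b)

/-- `v` is the weak derivative of `u` on `(a, b)`:
`∫ u φ' = - ∫ v φ` for every test function `φ ∈ C_c^∞(a, b)`. -/
def IsWeakDeriv (a b : ℝ) (u v : ℝ → ℂ) : Prop :=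
  ∀ φ : ℝ → ℝ, ContDiff ℝ ∞ φ → HasCompactSupport φ → tsupport φ ⊆ Ioo a b →
    ∫ x in Ioo a b, deriv φ x • u x = - ∫ x in Ioo a b, φ x • v x

theorem integrable_test_smul {a b : ℝ} {φ : ℝ → ℝ} (hφ : Continuous φ)
    (hc : HasCompactSupport φ) (u : L2 a b) :
    Integrable (fun x => φ x • u x) (volOn a b) := by
  have hu : Integrable (u : ℝ → ℂ) (volOn a b) := (Lp.memLp u).integrable (by norm_num)
  obtain ⟨C, hC⟩ := hc.exists_bound_of_continuous hφ
  exact hu.bdd_smul C hφ.aestronglyMeasurable (Eventually.of_forall hC)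

/-- The Sobolev space `H^m(Ω)`, `Ω = (a, b)`. An element is a function `u ∈ L²(Ω)` recorded
together with its (unique) weak derivatives `u', …, u^{(m)} ∈ L²(Ω)`: the `k`-th component of `w`
is the `k`-th weak derivative of `w 0`. The norm is `(∑_{k ≤ m} ‖u^{(k)}‖²_{L²})^{1/2}`. -/
def Sobolev (a b : ℝ) (m : ℕ) : Submodule ℂ (PiLp 2 (fun _ : Fin (m + 1) => L2 a b)) where
  carrier := {w | ∀ k : Fin m, IsWeakDeriv a b (w k.castSucc) (w k.succ)}
  zero_mem' := by
    intro k φ _ _ _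
    have h : ∀ j : ℝ → ℝ, ∫ x in Ioo a b, j x • ((0 : L2 a b) : ℝ → ℂ) x = 0 := by
      intro j
      rw [integral_eq_zero_of_ae]
      filter_upwards [Lp.coeFn_zero ℂ 2 (volOn a b)] with x hx
      rw [hx]; simp
    simp only [PiLp.zero_apply]
    rw [h, h, neg_zero]
  add_mem' := by
    intro w z hw hz k φ h1 h2 h3
    have key : ∀ j : ℝ → ℝ, Continuous j → HasCompactSupport j → ∀ u v : L2 a b,
        ∫ x in Ioo a b, j x • (u + v : L2 a b) x
          = (∫ x in Ioo a b, j x • u x) + ∫ x in Ioo a b, j x • v x := by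
      intro j hj hc u v
      rw [← integral_add (integrable_test_smul hj hc u) (integrable_test_smul hj hc v)]
      refine integral_congr_ae ?_
      filter_upwards [Lp.coeFn_add u v] with x hx
      rw [hx, Pi.add_apply, smul_add]
    simp only [PiLp.add_apply]
    rw [key _ (h1.continuous_deriv (by norm_num)) h2.deriv, key _ h1.continuous h2,
      hw k φ h1 h2 h3, hz k φ h1 h2 h3, neg_add]
  smul_mem' := by
    intro c w hw k φ h1 h2 h3
    have key : ∀ (j : ℝ → ℝ) (u : L2 a b),
        ∫ x in Ioo a b, j x • (c • u : L2 a b) x = c * ∫ x in Ioo a b, j x • u x := by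
      intro j u
      rw [← integral_const_mul]
      refine integral_congr_ae ?_
      filter_upwards [Lp.coeFn_smul c u] with x hx
      simp [hx]
      ring
    simp only [PiLp.smul_apply]
    rw [key, key, hw k φ h1 h2 h3, mul_neg]

/-- The `k`-th weak derivative of an element of `H^m(Ω)`; `k = 0` is the function itself. -/
def wderiv {a b : ℝ} {m : ℕ} (w : Sobolev a b m) (k : Fin (m + 1)) : L2 a b :=
  (w : PiLp 2 (fun _ : Fin (m + 1) => L2 a b)) k

/-- `w ∈ H^m_per(Ω)`: `w^{(k)}(a) = w^{(k)}(b)` for `k = 0, …, m - 1`, the boundary values being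
those of the representative of `w^{(k)}` that is continuous on `[a, b]`. -/
def IsPeriodic {a b : ℝ} {m : ℕ} (w : Sobolev a b m) : Prop :=
  ∀ k : Fin m, ∃ g : ℝ → ℂ, ContinuousOn g (Icc a b) ∧
    wderiv w k.castSucc =ᵐ[volOn a b] g ∧ g a = g b

/-- The `H^m(Ω)` norm of a function, with value `∞` if the function is not in `H^m(Ω)`.
(The infimum is over at most one `w`, as weak derivatives are unique.) -/
def sobolevNorm (a b : ℝ) (m : ℕ) (u : ℝ → ℂ) : ℝ≥0∞ :=
  ⨅ (w : Sobolev a b m) (_ : u =ᵐ[volOn a b] wderiv w 0), ‖w‖ₑ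

/-- The operator `B(v) = V v + f(|v|²) v` with `f(ρ) = β ρ^σ`. -/
def opB (V : ℝ → ℝ) (β σ : ℝ) (v : ℝ → ℂ) (x : ℝ) : ℂ :=
  (V x : ℂ) * v x + ((β * (‖v x‖ ^ 2) ^ σ : ℝ) : ℂ) * v x

/-- `ψ` is a solution, on the time interval `[0, T]`, of the nonlinear Schrödinger equation
`i ∂ₜψ = -ψ_xx + V ψ + β |ψ|^{2σ} ψ` on `(a, b)` with periodic boundary conditions and initial
value `ψ₀`, in the class `C([0,T]; H²_per(Ω)) ∩ C¹([0,T]; L²(Ω))`. -/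
structure IsNLSSolution (a b T : ℝ) (V : ℝ → ℝ) (β σ : ℝ) (ψ₀ : ℝ → ℂ)
    (ψ : ℝ → Sobolev a b 2) : Prop where
  periodic : ∀ t ∈ Icc 0 T, IsPeriodic (ψ t)
  continuousOn : ContinuousOn ψ (Icc 0 T)
  contDiffOn : ContDiffOn ℝ 1 (fun t => wderiv (ψ t) 0) (Icc 0 T)
  initial : ψ₀ =ᵐ[volOn a b] wderiv (ψ 0) 0
  equation : ∀ t ∈ Ioc 0 T, ∀ᵐ x ∂(volOn a b),
    Complex.I * derivWithin (fun s => wderiv (ψ s) 0) (Icc 0 T) t x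
      = - wderiv (ψ t) 2 x + opB V β σ (wderiv (ψ t) 0) x

/-- The frequency `μ_l = 2πl / (b - a)`. -/
def freq (a b : ℝ) (l : ℤ) : ℝ := 2 * Real.pi * l / (b - a)

/-- The Fourier coefficient `(1/(b-a)) ∫_a^b u(x) e^{-i μ_l (x-a)} dx`. -/
def fourierCoef (a b : ℝ) (u : ℝ → ℂ) (l : ℤ) : ℂ :=
  ((1 / (b - a) : ℝ) : ℂ) *
    ∫ x in a..b, u x * Complex.exp (-Complex.I * freq a b l * (x - a))

/-- The index set `{-N/2, …, N/2 - 1}` (for even `N`). -/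
def indexSet (N : ℕ) : Finset ℤ := Finset.Ico (-((N : ℤ) / 2)) ((N : ℤ) / 2)

/-- The element `∑_{l ∈ indexSet N} c_l e^{i μ_l (x-a)}` of the trigonometric space `X_N`. -/
def trigPoly (a b : ℝ) (N : ℕ) (c : ℤ → ℂ) (x : ℝ) : ℂ :=
  ∑ l ∈ indexSet N, c l * Complex.exp (Complex.I * freq a b l * (x - a))

/-- The entire function `φ₁(z) = (e^z - 1) / z`, `φ₁(0) = 1`. -/
def phi1 (z : ℂ) : ℂ := if z = 0 then 1 else (Complex.exp z - 1) / z

/-- The numerical solution `ψ_h^n ∈ X_N` of the sEWI Fourier spectral scheme. -/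
def sEWIFS (a b : ℝ) (V : ℝ → ℝ) (β σ : ℝ) (ψ₀ : ℝ → ℂ) (τ : ℝ) (N : ℕ) : ℕ → ℝ → ℂ
  | 0 => trigPoly a b N (fourierCoef a b ψ₀)
  | 1 =>
    let u₀ := trigPoly a b N (fourierCoef a b ψ₀)
    trigPoly a b N fun l =>
      Complex.exp (-Complex.I * τ * freq a b l ^ 2) * fourierCoef a b u₀ l
        - Complex.I * τ * phi1 (-Complex.I * τ * freq a b l ^ 2)
          * fourierCoef a b (opB V β σ u₀) l
  | n + 2 =>
    let u₀ := sEWIFS a b V β σ ψ₀ τ N n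
    let u₁ := sEWIFS a b V β σ ψ₀ τ N (n + 1)
    trigPoly a b N fun l =>
      Complex.exp (-2 * Complex.I * τ * freq a b l ^ 2) * fourierCoef a b u₀ l
        - 2 * Complex.I * τ * Complex.exp (-Complex.I * τ * freq a b l ^ 2)
          * (Real.sinc (τ * freq a b l ^ 2) : ℂ) * fourierCoef a b (opB V β σ u₁) l

end

/-! Parseval turns the whole problem into one about Fourier coefficients. Periodicity makes weak
differentiation act as multiplication by `I * freq a b l`. The coefficients of the exact solution
therefore solve `y' = -i μ² y - i g`, where `g` are the coefficients of `B(ψ)`.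

Consistency: the scheme is Duhamel's formula with `g` frozen, at the left end in the first step and
at the midpoint of an interval of length `2τ` afterwards. `B` is Lipschitz in `L²` on bounded
functions and `ψ` is Lipschitz in time with values in `L²`, so freezing costs `O(τ²)` per step. No
derivative of `V` or of the nonlinearity is needed. Modes outside `X_N` contribute `O(h²)` because
`ψ` is bounded in `H²`. If the numerical solution is bounded in the sup norm, a discrete Gronwall
argument gives the `L²` error `O(τ + h²)` (`IsSymmetricEWI.coefNorm_error_le`).

Stability in `H²`: `B(ψ_h)` need not lie in `H²`, so the scheme cannot simply be differentiated
twice. Instead, multiplying the filter `2iτ e^{-iτμ²} sinc(τμ²)` by `μ²` gives exactly `1 -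
e^{-2iτμ²}`. Hence `μ² u^{n+2} + G^{n+1}` is a unit phase times `μ² u^n + G^{n-1} + (G^{n+1} -
G^{n-1})`. The increment of `G` is controlled by that of `u`, which is `O(τ)` times the `H²` norm,
so Gronwall closes (`IsSymmetricEWI.coefNorm_mul_le`). This is the discrete form of bounding `ψ_xx`
through `ψ_t` and the equation.

Bootstrap: interpolating the `L²` error with the `H²` bounds gives an `H¹` error of order `(τ +
h²)^{1/2}`. In one dimension `H¹` controls the absolute sum of the Fourier coefficients, hence the
sup norm. For small `τ` and `h` the numerical solution thus stays within 1 of the exact bound `K`,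
and induction on the step removes the boundedness assumption. As the `H²` bound replaces inverse
inequalities, `τ` and `h` need not be related. -/

/-! ### Fourier coefficients, Parseval and trigonometric polynomials -/

theorem freq_neg (a b : ℝ) (l : ℤ) : freq a b (-l) = -freq a b l := by
  simp [freq, neg_div]

theorem norm_exp_freq (a b x : ℝ) (l : ℤ) :
    ‖Complex.exp (-Complex.I * freq a b l * (x - a))‖ = 1 := by
  rw [show -Complex.I * freq a b l * (x - a) = ((-(freq a b l * (x - a)) : ℝ) : ℂ) * Complex.I by
    push_cast; ring]
  exact Complex.norm_exp_ofReal_mul_I _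

theorem fourierCoef_eq_setIntegral {a b : ℝ} (hab : a < b) (f : ℝ → ℂ) (l : ℤ) :
    fourierCoef a b f l = ((1 / (b - a) : ℝ) : ℂ) *
      ∫ x in Ioo a b, f x * Complex.exp (-Complex.I * freq a b l * (x - a)) := by
  rw [fourierCoef, intervalIntegral.integral_of_le hab.le, integral_Ioc_eq_integral_Ioo]

theorem fourierCoef_congr_ae {a b : ℝ} (hab : a < b) {f g : ℝ → ℂ} (h : f =ᵐ[volOn a b] g)
    (l : ℤ) : fourierCoef a b f l = fourierCoef a b g l := by
  rw [fourierCoef_eq_setIntegral hab, fourierCoef_eq_setIntegral hab]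
  congr 1
  refine integral_congr_ae ?_
  filter_upwards [h] with x hx
  rw [hx]

/-- The two coefficients differ by a unit phase, since the exponentials here are based at `a` rather
than at `0`. Parseval, which sees only moduli, can therefore be imported. -/
theorem norm_fourierCoef_eq {a b : ℝ} (hab : a < b) (f : ℝ → ℂ) (l : ℤ) :
    ‖fourierCoef a b f l‖ = ‖fourierCoeffOn hab f l‖ := by
  have h : fourierCoef a b f l
      = Complex.exp ((freq a b l * a : ℝ) * Complex.I) * fourierCoeffOn hab f l := by
    rw [fourierCoef, fourierCoeffOn_eq_integral, Complex.real_smul, mul_left_comm]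
    congr 1
    rw [← intervalIntegral.integral_const_mul]
    refine intervalIntegral.integral_congr (E := ℂ) fun x _ => ?_
    simp only [fourier_coe_apply, smul_eq_mul]
    rw [← mul_assoc, ← Complex.exp_add, mul_comm]
    congr 2
    simp only [freq]
    push_cast
    ring
  rw [h, norm_mul, Complex.norm_exp_ofReal_mul_I, one_mul]

/-- Parseval's identity on `(a, b)`. -/
theorem hasSum_sq_fourierCoef {a b : ℝ} (hab : a < b) {f : ℝ → ℂ} (hf : MemLp f 2 (volOn a b)) :
    HasSum (fun l => ‖fourierCoef a b f l‖ ^ 2) ((b - a)⁻¹ * ∫ x in Ioo a b, ‖f x‖ ^ 2) := by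
  have h := hasSum_sq_fourierCoeffOn hab (f := f) (by rwa [← restrict_Ioo_eq_restrict_Ioc])
  simp only [norm_fourierCoef_eq hab]
  rwa [intervalIntegral.integral_of_le hab.le, integral_Ioc_eq_integral_Ioo, smul_eq_mul] at h

theorem norm_L2_sq {a b : ℝ} (f : L2 a b) : ‖f‖ ^ 2 = ∫ x in Ioo a b, ‖f x‖ ^ 2 := by
  have h := congrArg Complex.re (@L2.inner_def ℝ ℂ ℂ _ _ (volOn a b) _ _ f f)
  rw [inner_self_eq_norm_sq_to_K] at h
  have h2 : (∫ x in Ioo a b, inner ℂ (f x) (f x)) = ((∫ x in Ioo a b, ‖f x‖ ^ 2 : ℝ) : ℂ) := by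
    rw [← integral_complex_ofReal]
    refine integral_congr_ae (Eventually.of_forall fun x => ?_)
    simp only [inner_self_eq_norm_sq_to_K]
    norm_cast
  rw [h2] at h
  simpa [← Complex.ofReal_pow] using h

theorem hasSum_sq_fourierCoef_L2 {a b : ℝ} (hab : a < b) (f : L2 a b) :
    HasSum (fun l => ‖fourierCoef a b f l‖ ^ 2) ((b - a)⁻¹ * ‖f‖ ^ 2) := by
  rw [norm_L2_sq]
  exact hasSum_sq_fourierCoef hab (Lp.memLp f)

theorem integrable_mul_exp_freq {a b : ℝ} {f : ℝ → ℂ} (hf : MemLp f 2 (volOn a b)) (l : ℤ) :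
    Integrable (fun x => f x * Complex.exp (-Complex.I * freq a b l * (x - a))) (volOn a b) := by
  have hi : Integrable f (volOn a b) := hf.integrable (by norm_num)
  refine hi.mul_bdd (c := 1) (Continuous.aestronglyMeasurable (by fun_prop)) ?_
  exact Eventually.of_forall fun x => (norm_exp_freq a b x l).le

theorem fourierCoef_add {a b : ℝ} (hab : a < b) {f g : ℝ → ℂ} (hf : MemLp f 2 (volOn a b))
    (hg : MemLp g 2 (volOn a b)) (l : ℤ) :
    fourierCoef a b (fun x => f x + g x) l = fourierCoef a b f l + fourierCoef a b g l := by
  simp only [fourierCoef_eq_setIntegral hab, add_mul]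
  rw [integral_add (integrable_mul_exp_freq hf l) (integrable_mul_exp_freq hg l), mul_add]

theorem fourierCoef_const_mul (a b : ℝ) (c : ℂ) (f : ℝ → ℂ) (l : ℤ) :
    fourierCoef a b (fun x => c * f x) l = c * fourierCoef a b f l := by
  simp only [fourierCoef, mul_assoc, intervalIntegral.integral_const_mul]
  ring

theorem fourierCoef_sub {a b : ℝ} (hab : a < b) {f g : ℝ → ℂ} (hf : MemLp f 2 (volOn a b))
    (hg : MemLp g 2 (volOn a b)) (l : ℤ) :
    fourierCoef a b (fun x => f x - g x) l = fourierCoef a b f l - fourierCoef a b g l := by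
  simp only [fourierCoef_eq_setIntegral hab, sub_mul]
  rw [integral_sub (integrable_mul_exp_freq hf l) (integrable_mul_exp_freq hg l), mul_sub]

/-- The `l`-th Fourier coefficient as a continuous linear functional on `L²(a, b)`. -/
noncomputable def fourierCoefL (a b : ℝ) (hab : a < b) (l : ℤ) : L2 a b →L[ℂ] ℂ :=
  LinearMap.mkContinuous
    { toFun := fun f => fourierCoef a b f l
      map_add' := fun f g => by
        rw [← fourierCoef_add hab (Lp.memLp f) (Lp.memLp g)]
        exact fourierCoef_congr_ae hab (Lp.coeFn_add f g) l
      map_smul' := fun c f => by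
        rw [RingHom.id_apply, smul_eq_mul, ← fourierCoef_const_mul]
        exact fourierCoef_congr_ae hab (Lp.coeFn_smul c f) l }
    (Real.sqrt (b - a)⁻¹) (fun f => by
      have h := (hasSum_sq_fourierCoef_L2 hab f)
      have h2 := le_hasSum h l (fun _ _ => by positivity)
      refine le_of_sq_le_sq ?_ (by positivity)
      rw [mul_pow, Real.sq_sqrt (inv_nonneg.2 (sub_pos.2 hab).le)]
      exact h2)

theorem continuous_trigPoly (a b : ℝ) (N : ℕ) (c : ℤ → ℂ) : Continuous (trigPoly a b N c) := by
  unfold trigPoly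
  fun_prop

theorem memLp_of_continuous {a b : ℝ} {f : ℝ → ℂ} (hf : Continuous f) (p : ℝ≥0∞) :
    MemLp f p (volOn a b) := by
  obtain ⟨C, hC⟩ := (isCompact_Icc (a := a) (b := b)).exists_bound_of_continuousOn hf.continuousOn
  refine MemLp.of_bound hf.aestronglyMeasurable C ?_
  filter_upwards [ae_restrict_mem measurableSet_Ioo] with x hx
  exact hC x (Ioo_subset_Icc_self hx)

theorem memLp_trigPoly (a b : ℝ) (N : ℕ) (c : ℤ → ℂ) : MemLp (trigPoly a b N c) 2 (volOn a b) :=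
  memLp_of_continuous (continuous_trigPoly a b N c) 2

theorem fourierCoef_exp {a b : ℝ} (hab : a < b) (k l : ℤ) :
    fourierCoef a b (fun x => Complex.exp (Complex.I * freq a b k * (x - a))) l
      = if l = k then 1 else 0 := by
  have hba : (b : ℂ) - a ≠ 0 := by
    rw [← Complex.ofReal_sub]; exact Complex.ofReal_ne_zero.2 (sub_pos.2 hab).ne'
  have h : ∀ x : ℝ, Complex.exp (Complex.I * freq a b k * (x - a)) *
      Complex.exp (-Complex.I * freq a b l * (x - a))
      = Complex.exp (2 * Real.pi * Complex.I * (k - l : ℤ) / (b - a) * (x - a)) := by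
    intro x
    rw [← Complex.exp_add]
    congr 1
    simp only [freq]
    push_cast
    ring
  simp only [fourierCoef, h]
  split_ifs with hlk
  · subst hlk
    simp only [sub_self, Int.cast_zero, mul_zero, zero_div, zero_mul, Complex.exp_zero]
    rw [intervalIntegral.integral_const]
    simp only [Complex.real_smul, mul_one]
    push_cast
    field_simp
  · have hc : (2 * Real.pi * Complex.I * (k - l : ℤ) / (b - a) : ℂ) ≠ 0 := by
      have : ((k - l : ℤ) : ℂ) ≠ 0 := by
        exact_mod_cast sub_ne_zero.2 (Ne.symm hlk)
      have h2 : (2 * Real.pi * Complex.I : ℂ) ≠ 0 := Complex.two_pi_I_ne_zero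
      exact div_ne_zero (mul_ne_zero h2 this) hba
    have hsub : ∀ x : ℝ, Complex.exp (2 * Real.pi * Complex.I * (k - l : ℤ) / (b - a) * (x - a))
        = Complex.exp (-(2 * Real.pi * Complex.I * (k - l : ℤ) / (b - a) * a)) *
          Complex.exp (2 * Real.pi * Complex.I * (k - l : ℤ) / (b - a) * x) := by
      intro x; rw [← Complex.exp_add]; congr 1; ring
    simp only [hsub]
    rw [intervalIntegral.integral_const_mul, integral_exp_mul_complex hc]
    have hper : Complex.exp (2 * Real.pi * Complex.I * (k - l : ℤ) / (b - a) * b)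
        = Complex.exp (2 * Real.pi * Complex.I * (k - l : ℤ) / (b - a) * a) := by
      rw [Complex.exp_eq_exp_iff_exists_int]
      refine ⟨k - l, ?_⟩
      field_simp
      ring
    rw [hper, sub_self, zero_div, mul_zero, mul_zero]

theorem fourierCoef_trigPoly {a b : ℝ} (hab : a < b) (N : ℕ) (c : ℤ → ℂ) (l : ℤ) :
    fourierCoef a b (trigPoly a b N c) l = if l ∈ indexSet N then c l else 0 := by
  have h : ∀ s : Finset ℤ, fourierCoef a b
      (fun x => ∑ k ∈ s, c k * Complex.exp (Complex.I * freq a b k * (x - a))) l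
      = ∑ k ∈ s, c k * if l = k then 1 else 0 := by
    intro s
    induction s using Finset.induction_on with
    | empty => simp [fourierCoef]
    | insert k s hk ih =>
      simp only [Finset.sum_insert hk]
      rw [fourierCoef_add hab (memLp_of_continuous (by fun_prop) 2)
        (memLp_of_continuous (by fun_prop) 2), ih, fourierCoef_const_mul, fourierCoef_exp hab]
  have h2 := h (indexSet N)
  simp only [mul_ite, mul_one, mul_zero, Finset.sum_ite_eq] at h2
  exact h2

theorem trigPoly_congr {a b : ℝ} {N : ℕ} {c d : ℤ → ℂ} (h : ∀ l ∈ indexSet N, c l = d l) :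
    trigPoly a b N c = trigPoly a b N d := by
  funext x
  exact Finset.sum_congr rfl fun l hl => by rw [h l hl]

theorem trigPoly_fourierCoef_trigPoly {a b : ℝ} (hab : a < b) (N : ℕ) (c : ℤ → ℂ) :
    trigPoly a b N (fourierCoef a b (trigPoly a b N c)) = trigPoly a b N c :=
  trigPoly_congr fun l hl => by rw [fourierCoef_trigPoly hab, if_pos hl]

theorem norm_trigPoly_le (a b : ℝ) (N : ℕ) (c : ℤ → ℂ) (x : ℝ) :
    ‖trigPoly a b N c x‖ ≤ ∑ l ∈ indexSet N, ‖c l‖ := by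
  refine (norm_sum_le _ _).trans (Finset.sum_le_sum fun l _ => ?_)
  have := norm_exp_freq a b x (-l)
  rw [freq_neg] at this
  rw [norm_mul, show Complex.I * freq a b l * (x - a)
    = -Complex.I * ((-freq a b l : ℝ) : ℂ) * (x - a) by push_cast; ring, this, mul_one]

theorem mem_indexSet {N : ℕ} (l : ℤ) :
    l ∈ indexSet N ↔ -((N : ℤ) / 2) ≤ l ∧ l < (N : ℤ) / 2 := by
  simp [indexSet]

/-- A square integrable function is bounded by the sum of the moduli of its Fourier
coefficients. -/
theorem ae_norm_le_of_sum_le {a b : ℝ} (hab : a < b) {f : ℝ → ℂ} (hf : MemLp f 2 (volOn a b))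
    {S : ℝ} (hS : ∀ s : Finset ℤ, ∑ l ∈ s, ‖fourierCoef a b f l‖ ≤ S) :
    ∀ᵐ x ∂(volOn a b), ‖f x‖ ≤ S := by
  have hba : 0 < b - a := sub_pos.2 hab
  set p : ℕ → ℝ → ℂ := fun n => trigPoly a b (2 * n) (fourierCoef a b f) with hp
  have hmem : ∀ n, MemLp (fun x => p n x - f x) 2 (volOn a b) := fun n =>
    (memLp_trigPoly a b _ _).sub hf
  have hI : Tendsto (fun n : ℕ => indexSet (2 * n)) atTop atTop := by
    refine tendsto_atTop_finset_of_monotone ?_ ?_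
    · intro m n hmn l hl
      rw [mem_indexSet] at hl ⊢
      push_cast at hl ⊢
      omega
    · intro l
      refine ⟨l.natAbs + 1, ?_⟩
      rw [mem_indexSet]
      push_cast [Int.natCast_natAbs]
      have := neg_abs_le l
      have := le_abs_self l
      omega
  -- Parseval for the tail: the partial sum removes exactly the coefficients in the index set.
  have hint : ∀ n, ∫ x in Ioo a b, ‖p n x - f x‖ ^ 2
      = (b - a) * ((b - a)⁻¹ * (∫ x in Ioo a b, ‖f x‖ ^ 2)
        - ∑ l ∈ indexSet (2 * n), ‖fourierCoef a b f l‖ ^ 2) := by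
    intro n
    have h1 := hasSum_sq_fourierCoef hab (hmem n)
    have h2 := (hasSum_sq_fourierCoef hab hf).sub
      (hasSum_sum_of_ne_finset_zero (s := indexSet (2 * n))
        (f := fun l => if l ∈ indexSet (2 * n) then ‖fourierCoef a b f l‖ ^ 2 else 0)
        (fun l hl => if_neg hl))
    have h3 : (fun l => ‖fourierCoef a b (fun x => p n x - f x) l‖ ^ 2) = fun l =>
        ‖fourierCoef a b f l‖ ^ 2
          - if l ∈ indexSet (2 * n) then ‖fourierCoef a b f l‖ ^ 2 else 0 := by
      funext l
      rw [fourierCoef_sub hab (memLp_trigPoly a b _ _) hf, fourierCoef_trigPoly hab]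
      split_ifs <;> simp
    rw [h3] at h1
    have h4 := h1.unique h2
    rw [Finset.sum_congr rfl (fun l hl => if_pos hl)] at h4
    rw [← h4]
    field_simp
  have hlim : Tendsto (fun n => ∫ x in Ioo a b, ‖p n x - f x‖ ^ 2) atTop (nhds 0) := by
    simp only [hint]
    have h1 : Tendsto (fun n : ℕ => ∑ l ∈ indexSet (2 * n), ‖fourierCoef a b f l‖ ^ 2) atTop
        (nhds ((b - a)⁻¹ * (∫ x in Ioo a b, ‖f x‖ ^ 2))) :=
      (hasSum_sq_fourierCoef hab hf).comp hI
    have h2 := ((tendsto_const_nhds (x := (b - a)⁻¹ * (∫ x in Ioo a b, ‖f x‖ ^ 2))).sub h1).const_mul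
      (b - a)
    simpa using h2
  -- Convergence in `L²` gives convergence in measure, hence almost everywhere along a subsequence,
  -- and every partial sum obeys the bound pointwise.
  have hconv : TendstoInMeasure (volOn a b) p atTop f := by
    refine tendstoInMeasure_of_tendsto_eLpNorm (p := 2) (by norm_num)
      (fun n => (memLp_trigPoly a b _ _).1) hf.1 ?_
    have h1 : ∀ n, eLpNorm (p n - f) 2 (volOn a b)
        = ENNReal.ofReal ((∫ x in Ioo a b, ‖p n x - f x‖ ^ 2) ^ (1 / 2 : ℝ)) := by
      intro n
      have := (hmem n).eLpNorm_eq_integral_rpow_norm (by norm_num) (by norm_num)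
      simp only [ENNReal.toReal_ofNat, Real.rpow_ofNat] at this
      rw [one_div, ← this]
      rfl
    simp only [h1]
    have h2 := hlim.rpow_const (p := (1 / 2 : ℝ)) (Or.inr (by norm_num))
    rw [Real.zero_rpow (by norm_num)] at h2
    simpa using ENNReal.tendsto_ofReal h2
  obtain ⟨ns, -, hns⟩ := hconv.exists_seq_tendsto_ae
  filter_upwards [hns] with x hx
  refine le_of_tendsto hx.norm (Eventually.of_forall fun n => ?_)
  exact (norm_trigPoly_le a b _ _ x).trans (hS _)

/-! ### Cut-offs and Fourier coefficients of periodic weak derivatives -/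

theorem exists_bound_deriv_smoothTransition :
    ∃ D : ℝ, 0 ≤ D ∧ (∀ y, ‖deriv Real.smoothTransition y‖ ≤ D) ∧
      ∀ y, 1 < y → deriv Real.smoothTransition y = 0 := by
  have hone : ∀ y, 1 < y → deriv Real.smoothTransition y = 0 := by
    intro y hy
    have : Real.smoothTransition =ᶠ[nhds y] fun _ => 1 := by
      filter_upwards [lt_mem_nhds hy] with z hz
      exact Real.smoothTransition.one_of_one_le hz.le
    rw [this.deriv_eq, deriv_const]
  have hzero : ∀ y, y < 0 → deriv Real.smoothTransition y = 0 := by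
    intro y hy
    have : Real.smoothTransition =ᶠ[nhds y] fun _ => 0 := by
      filter_upwards [gt_mem_nhds hy] with z hz
      exact Real.smoothTransition.zero_of_nonpos (le_of_lt hz)
    rw [this.deriv_eq, deriv_const]
  have hc : Continuous (deriv Real.smoothTransition) :=
    (Real.smoothTransition.contDiff (n := 1)).continuous_deriv (by norm_num)
  obtain ⟨D, hD⟩ := (isCompact_Icc (a := (0 : ℝ)) (b := 1)).exists_bound_of_continuousOn
    hc.continuousOn
  have hD0 : 0 ≤ D := (norm_nonneg _).trans (hD 0 ⟨le_rfl, zero_le_one⟩)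
  refine ⟨D, hD0, fun y => ?_, hone⟩
  rcases lt_or_ge y 0 with h | h
  · rw [hzero y h, norm_zero]; exact hD0
  · rcases lt_or_ge 1 y with h1 | h1
    · rw [hone y h1, norm_zero]; exact hD0
    · exact hD y ⟨h, h1⟩

/-- A smooth cut-off function which is supported in `[a + 1/r, b - 1/r]` and equal to `1` on
`[a + 2/r, b - 2/r]`. -/
noncomputable def cutoff (a b r x : ℝ) : ℝ :=
  Real.smoothTransition (r * (x - a) - 1) * Real.smoothTransition (r * (b - x) - 1)

theorem contDiff_cutoff (a b r : ℝ) : ContDiff ℝ ∞ (cutoff a b r) := by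
  have h : ContDiff ℝ ∞ Real.smoothTransition := Real.smoothTransition.contDiff
  exact (h.comp (by fun_prop)).mul (h.comp (by fun_prop))

theorem tsupport_cutoff_subset {r : ℝ} (a b : ℝ) (hr : 0 < r) :
    tsupport (cutoff a b r) ⊆ Icc (a + 1 / r) (b - 1 / r) := by
  refine closure_minimal (fun x hx => ?_) isClosed_Icc
  have hx' : cutoff a b r x ≠ 0 := hx
  have h1 := left_ne_zero_of_mul hx'
  have h2 := right_ne_zero_of_mul hx'
  have h3 : 0 < r * (x - a) - 1 := by
    by_contra h; exact h1 (Real.smoothTransition.zero_of_nonpos (not_lt.1 h))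
  have h4 : 0 < r * (b - x) - 1 := by
    by_contra h; exact h2 (Real.smoothTransition.zero_of_nonpos (not_lt.1 h))
  have h5 : 1 / r < x - a := by rw [div_lt_iff₀ hr]; linarith
  have h6 : 1 / r < b - x := by rw [div_lt_iff₀ hr]; linarith
  exact ⟨by linarith, by linarith⟩

theorem norm_cutoff_le_one (a b r x : ℝ) : ‖cutoff a b r x‖ ≤ 1 := by
  have h1 := Real.smoothTransition.nonneg (r * (x - a) - 1)
  have h2 := Real.smoothTransition.nonneg (r * (b - x) - 1)
  have h3 := Real.smoothTransition.le_one (r * (x - a) - 1)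
  have h4 := Real.smoothTransition.le_one (r * (b - x) - 1)
  rw [Real.norm_eq_abs, cutoff, abs_of_nonneg (mul_nonneg h1 h2)]
  exact mul_le_one₀ h3 h2 h4

theorem tendsto_cutoff {a b x : ℝ} (hx : x ∈ Ioo a b) :
    Tendsto (fun n : ℕ => cutoff a b n x) atTop (nhds 1) := by
  have h1 : 0 < x - a := sub_pos.2 hx.1
  have h2 : 0 < b - x := sub_pos.2 hx.2
  refine tendsto_const_nhds.congr' ?_
  have e1 := (tendsto_natCast_atTop_atTop (R := ℝ)).eventually_ge_atTop (2 / (x - a))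
  have e2 := (tendsto_natCast_atTop_atTop (R := ℝ)).eventually_ge_atTop (2 / (b - x))
  filter_upwards [e1, e2] with n hn1 hn2
  rw [div_le_iff₀ h1] at hn1
  rw [div_le_iff₀ h2] at hn2
  rw [cutoff, Real.smoothTransition.one_of_one_le (by linarith),
    Real.smoothTransition.one_of_one_le (by linarith), mul_one]

/-- The derivative lives in two boundary layers; inside `(a, b)` each has width at most `2 / r` and
height `r * D`, so its mass is bounded uniformly in `r`. -/
theorem norm_deriv_cutoff_le {D : ℝ} (hD : ∀ y, ‖deriv Real.smoothTransition y‖ ≤ D)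
    (h1 : ∀ y, 1 < y → deriv Real.smoothTransition y = 0) (a b : ℝ) {r : ℝ} (hr : 0 < r) (x : ℝ) :
    ‖deriv (cutoff a b r) x‖ ≤
      (Iic (a + 2 / r)).indicator (fun _ => r * D) x
        + (Ici (b - 2 / r)).indicator (fun _ => r * D) x := by
  have hS : Differentiable ℝ Real.smoothTransition :=
    (Real.smoothTransition.contDiff (n := 1)).differentiable (by norm_num)
  have hd1 : HasDerivAt (fun x => Real.smoothTransition (r * (x - a) - 1))
      (deriv Real.smoothTransition (r * (x - a) - 1) * (r * 1)) x :=
    (hS _).hasDerivAt.comp x ((((hasDerivAt_id x).sub_const a).const_mul r).sub_const 1)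
  have hd2 : HasDerivAt (fun x => Real.smoothTransition (r * (b - x) - 1))
      (deriv Real.smoothTransition (r * (b - x) - 1) * (r * -1)) x :=
    (hS _).hasDerivAt.comp x ((((hasDerivAt_id x).const_sub b).const_mul r).sub_const 1)
  have hS1 : ∀ y, ‖Real.smoothTransition y‖ ≤ 1 := fun y => by
    rw [Real.norm_eq_abs, abs_of_nonneg (Real.smoothTransition.nonneg y)]
    exact Real.smoothTransition.le_one y
  have hD0 : 0 ≤ D := (norm_nonneg _).trans (hD 0)
  have hd : HasDerivAt (cutoff a b r) _ x := hd1.mul hd2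
  rw [hd.deriv]
  refine (norm_add_le _ _).trans (add_le_add ?_ ?_)
  · by_cases hx : x ∈ Iic (a + 2 / r)
    · rw [indicator_of_mem hx, norm_mul, norm_mul, mul_one, Real.norm_of_nonneg hr.le]
      calc _ ≤ D * r * 1 := by gcongr; exacts [hD _, hS1 _]
        _ = r * D := by ring
    · rw [indicator_of_notMem hx, h1, zero_mul, zero_mul, norm_zero]
      have : 2 / r < x - a := by simp only [mem_Iic, not_le] at hx; linarith
      rw [div_lt_iff₀ hr] at this
      linarith
  · by_cases hx : x ∈ Ici (b - 2 / r)
    · rw [indicator_of_mem hx, norm_mul, norm_mul, norm_mul, norm_neg, norm_one, mul_one,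
        Real.norm_of_nonneg hr.le]
      calc _ ≤ 1 * (D * r) := by gcongr; exacts [hS1 _, hD _]
        _ = r * D := by ring
    · rw [indicator_of_notMem hx, h1, zero_mul, mul_zero, norm_zero]
      have : 2 / r < b - x := by simp only [mem_Ici, not_le] at hx; linarith
      rw [div_lt_iff₀ hr] at this
      linarith

/-- The derivative of the cut-off has integral zero and bounded mass concentrating at the two ends.
As `f a = f b`, this common value can be subtracted, and what remains is small in both layers. -/
theorem tendsto_integral_deriv_cutoff_smul {a b : ℝ} (hab : a < b) {f : ℝ → ℂ}
    (hf : ContinuousOn f (Icc a b)) (hfab : f a = f b) :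
    Tendsto (fun n : ℕ => ∫ x in Ioo a b, deriv (cutoff a b n) x • f x) atTop (nhds 0) := by
  obtain ⟨D, hD0, hD, hD1⟩ := exists_bound_deriv_smoothTransition
  rw [Metric.tendsto_atTop]
  intro ε hε
  -- The layers have total mass at most `4 * D`; the `+ 1` keeps the denominator positive and the
  -- final inequality strict.
  set η := ε / (4 * D + 1) with hη
  have hηpos : 0 < η := by positivity
  obtain ⟨δ₁, hδ₁, H₁⟩ := Metric.continuousOn_iff.1 hf a (left_mem_Icc.2 hab.le) η hηpos
  obtain ⟨δ₂, hδ₂, H₂⟩ := Metric.continuousOn_iff.1 hf b (right_mem_Icc.2 hab.le) η hηpos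
  obtain ⟨n₀, hn₀⟩ := exists_nat_gt (max (2 / δ₁) (2 / δ₂))
  refine ⟨n₀, fun n hn => ?_⟩
  have hnn : max (2 / δ₁) (2 / δ₂) < n := hn₀.trans_le (by exact_mod_cast hn)
  have hnpos : (0 : ℝ) < n := lt_of_le_of_lt (by positivity) hnn
  have h1 : 2 / (n : ℝ) < δ₁ := by
    rw [div_lt_comm₀ hnpos hδ₁]; exact (le_max_left _ _).trans_lt hnn
  have h2 : 2 / (n : ℝ) < δ₂ := by
    rw [div_lt_comm₀ hnpos hδ₂]; exact (le_max_right _ _).trans_lt hnn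
  have hcd : Continuous (deriv (cutoff a b n)) :=
    (contDiff_cutoff a b n).continuous_deriv (by norm_num)
  have hχ0 : ∫ x in Ioo a b, deriv (cutoff a b n) x • f a = 0 := by
    rw [integral_smul_const, ← integral_Ioc_eq_integral_Ioo,
      ← intervalIntegral.integral_of_le hab.le, intervalIntegral.integral_deriv_eq_sub]
    · simp [cutoff, Real.smoothTransition.zero_of_nonpos]
    · exact fun x _ => ((contDiff_cutoff a b n).differentiable (by norm_num)) x
    · exact hcd.intervalIntegrable _ _
  have hintf : Integrable (fun x => deriv (cutoff a b n) x • f x) (volOn a b) :=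
    ((hcd.continuousOn.smul hf).integrableOn_Icc).mono_set Ioo_subset_Icc_self
  have hintc : Integrable (fun x => deriv (cutoff a b n) x • f a) (volOn a b) :=
    ((hcd.continuousOn.smul continuousOn_const).integrableOn_Icc).mono_set Ioo_subset_Icc_self
  have hsub : ∫ x in Ioo a b, deriv (cutoff a b n) x • f x
      = ∫ x in Ioo a b, deriv (cutoff a b n) x • (f x - f a) := by
    simp only [smul_sub]
    rw [integral_sub hintf hintc, hχ0, sub_zero]
  rw [dist_zero_right, hsub]
  set G : ℝ → ℝ := fun x => (Ioc a (a + 2 / (n : ℝ))).indicator (fun _ => n * D * η) x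
    + (Ico (b - 2 / (n : ℝ)) b).indicator (fun _ => n * D * η) x with hG
  have hG1 : IntegrableOn (fun _ : ℝ => (n * D * η : ℝ)) (Ioc a (a + 2 / (n : ℝ))) :=
    integrableOn_const (by simp)
  have hG2 : IntegrableOn (fun _ : ℝ => (n * D * η : ℝ)) (Ico (b - 2 / (n : ℝ)) b) :=
    integrableOn_const (by simp)
  have hG1' := hG1.integrable_indicator measurableSet_Ioc
  have hG2' := hG2.integrable_indicator measurableSet_Ico
  have hGint : Integrable G := hG1'.add hG2'
  have hGval : ∫ x, G x = 4 * D * η := by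
    rw [hG, integral_add hG1' hG2', integral_indicator measurableSet_Ioc,
      integral_indicator measurableSet_Ico, setIntegral_const, setIntegral_const]
    have h4 : (0 : ℝ) ≤ 2 / n := by positivity
    simp only [Real.volume_real_Ioc, Real.volume_real_Ico, smul_eq_mul]
    rw [add_sub_cancel_left, sub_sub_cancel, max_eq_left h4]
    field_simp
    ring
  have hGnn : ∀ x, 0 ≤ G x := fun x =>
    add_nonneg (indicator_nonneg (fun _ _ => by positivity) _)
      (indicator_nonneg (fun _ _ => by positivity) _)
  have hle : ‖∫ x in Ioo a b, deriv (cutoff a b n) x • (f x - f a)‖ ≤ ∫ x, G x := by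
    refine (norm_integral_le_of_norm_le (hGint.restrict (s := Ioo a b)) ?_).trans
      (setIntegral_le_integral hGint (Eventually.of_forall hGnn))
    filter_upwards [ae_restrict_mem measurableSet_Ioo] with x hx
    have hb := norm_deriv_cutoff_le hD hD1 a b hnpos x
    rw [norm_smul]
    refine (mul_le_mul_of_nonneg_right hb (norm_nonneg _)).trans ?_
    rw [add_mul]
    refine add_le_add ?_ ?_
    · by_cases hxa : x ∈ Iic (a + 2 / (n : ℝ))
      · rw [indicator_of_mem hxa, indicator_of_mem (show x ∈ Ioc a (a + 2 / (n : ℝ)) from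
          ⟨hx.1, hxa⟩)]
        have := (H₁ x (Ioo_subset_Icc_self hx) (by
          rw [Real.dist_eq, abs_of_pos (sub_pos.2 hx.1)]; have : x ≤ _ := hxa; linarith)).le
        rw [dist_eq_norm] at this
        gcongr
      · rw [indicator_of_notMem hxa, zero_mul]
        exact indicator_nonneg (fun _ _ => by positivity) _
    · by_cases hxa : x ∈ Ici (b - 2 / (n : ℝ))
      · rw [indicator_of_mem hxa, indicator_of_mem (show x ∈ Ico (b - 2 / (n : ℝ)) b from
          ⟨hxa, hx.2⟩)]
        have := (H₂ x (Ioo_subset_Icc_self hx) (by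
          rw [Real.dist_eq, abs_of_neg (sub_neg.2 hx.2)]; have : _ ≤ x := hxa; linarith)).le
        rw [dist_eq_norm, ← hfab] at this
        gcongr
      · rw [indicator_of_notMem hxa, zero_mul]
        exact indicator_nonneg (fun _ _ => by positivity) _
  refine hle.trans_lt ?_
  rw [hGval, hη, mul_div_assoc', div_lt_iff₀ (by positivity)]
  nlinarith

theorem tendsto_integral_cutoff_smul {a b : ℝ} {f : ℝ → ℂ} (hf : Integrable f (volOn a b)) :
    Tendsto (fun n : ℕ => ∫ x in Ioo a b, cutoff a b n x • f x) atTop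
      (nhds (∫ x in Ioo a b, f x)) := by
  refine tendsto_integral_of_dominated_convergence (fun x => ‖f x‖) (fun n => ?_) hf.norm
    (fun n => Eventually.of_forall fun x => ?_) ?_
  · exact ((contDiff_cutoff a b n).continuous.aestronglyMeasurable).smul hf.1
  · rw [norm_smul]
    exact mul_le_of_le_one_left (norm_nonneg _) (norm_cutoff_le_one a b n x)
  · filter_upwards [ae_restrict_mem measurableSet_Ioo] with x hx
    simpa using (tendsto_cutoff hx).smul_const (f x)

/-- Integration by parts of a periodic function against a periodic smooth function. -/
theorem IsWeakDeriv.integral_deriv_smul {a b : ℝ} (hab : a < b) {u v g : ℝ → ℂ}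
    (hu : MemLp u 2 (volOn a b)) (hv : MemLp v 2 (volOn a b)) (h : IsWeakDeriv a b u v)
    (hg : ContinuousOn g (Icc a b)) (hug : u =ᵐ[volOn a b] g) (hgab : g a = g b)
    {p : ℝ → ℝ} (hp : ContDiff ℝ ∞ p) (hpab : p a = p b) :
    ∫ x in Ioo a b, deriv p x • u x = - ∫ x in Ioo a b, p x • v x := by
  have hbdd : ∀ {q : ℝ → ℝ} {w : ℝ → ℂ}, Continuous q → MemLp w 2 (volOn a b) →
      Integrable (fun x => q x • w x) (volOn a b) := by
    intro q w hq hw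
    obtain ⟨C, hC⟩ := (isCompact_Icc (a := a) (b := b)).exists_bound_of_continuousOn
      hq.continuousOn
    refine (hw.integrable (by norm_num)).bdd_smul C hq.aestronglyMeasurable ?_
    filter_upwards [ae_restrict_mem measurableSet_Ioo] with x hx
    exact hC x (Ioo_subset_Icc_self hx)
  have hpd : Continuous (deriv p) := hp.continuous_deriv (by norm_num)
  -- The admissible test function is the cut-off times `p`. Of the two terms of the product rule,
  -- the one with the derivative of the cut-off vanishes in the limit by periodicity of `p * g`.
  have L1 := tendsto_integral_cutoff_smul (hbdd hpd hu)
  have L2 := (tendsto_integral_cutoff_smul (hbdd hp.continuous hv)).neg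
  have L3 := tendsto_integral_deriv_cutoff_smul hab (f := fun x => p x • g x)
    (hp.continuous.continuousOn.smul hg) (by rw [hpab, hgab])
  have L4 := L3.add L1
  rw [zero_add] at L4
  refine tendsto_nhds_unique (L4.congr' ?_) L2
  filter_upwards [eventually_gt_atTop 0] with n hn
  have hn' : (0 : ℝ) < n := by exact_mod_cast hn
  have hts := tsupport_cutoff_subset a b hn'
  have hts2 : tsupport (fun x => cutoff a b n x * p x) ⊆ Icc (a + 1 / (n : ℝ)) (b - 1 / n) :=
    (tsupport_mul_subset_left).trans hts
  have hcs : HasCompactSupport (fun x => cutoff a b n x * p x) :=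
    isCompact_Icc.of_isClosed_subset (isClosed_tsupport _) hts2
  have hpos : 0 < 1 / (n : ℝ) := by positivity
  have hw := h (fun x => cutoff a b n x * p x) ((contDiff_cutoff a b n).mul hp) hcs
    (hts2.trans (Icc_subset_Ioo (by linarith) (by linarith)))
  have hder : ∀ x, deriv (fun x => cutoff a b n x * p x) x
      = deriv (cutoff a b n) x * p x + cutoff a b n x * deriv p x := fun x =>
    deriv_fun_mul ((contDiff_cutoff a b n).differentiable (by norm_num) x)
      (hp.differentiable (by norm_num) x)
  simp only [hder, mul_smul] at hw
  rw [← hw]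
  have hcd : Continuous (deriv (cutoff a b n)) :=
    (contDiff_cutoff a b n).continuous_deriv (by norm_num)
  simp only [add_smul, mul_smul]
  rw [integral_add]
  · congr 1
    refine integral_congr_ae ?_
    filter_upwards [hug] with x hx
    rw [hx]
  · simpa only [Pi.mul_apply, mul_smul] using hbdd (hcd.mul hp.continuous) hu
  · simpa only [Pi.mul_apply, mul_smul] using
      hbdd ((contDiff_cutoff a b n).continuous.mul hpd) hu

/-- Test functions are real-valued, so the exponential is split into a cosine and a sine, both of
which take equal values at `a` and `b`. -/
theorem IsWeakDeriv.fourierCoef {a b : ℝ} (hab : a < b) {u v g : ℝ → ℂ}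
    (hu : MemLp u 2 (volOn a b)) (hv : MemLp v 2 (volOn a b)) (h : IsWeakDeriv a b u v)
    (hg : ContinuousOn g (Icc a b)) (hug : u =ᵐ[volOn a b] g) (hgab : g a = g b) (l : ℤ) :
    fourierCoef a b v l = Complex.I * freq a b l * fourierCoef a b u l := by
  set m := freq a b l with hm
  have hmb : m * (b - a) = 2 * Real.pi * l := by
    rw [hm, freq, div_mul_cancel₀ _ (sub_pos.2 hab).ne']
  have hcos : Real.cos (m * (b - a)) = 1 := by
    rw [hmb, mul_comm]; exact Real.cos_int_mul_two_pi l
  have hsin : Real.sin (m * (b - a)) = 0 := by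
    rw [hmb, show 2 * Real.pi * l = (2 * l : ℤ) * Real.pi by push_cast; ring]
    exact Real.sin_int_mul_pi _
  have hc := h.integral_deriv_smul hab hu hv hg hug hgab (p := fun x => Real.cos (m * (x - a)))
    (Real.contDiff_cos.comp (by fun_prop)) (by simp [hcos])
  have hs := h.integral_deriv_smul hab hu hv hg hug hgab (p := fun x => Real.sin (m * (x - a)))
    (Real.contDiff_sin.comp (by fun_prop)) (by simp [hsin])
  have hdc : ∀ x, deriv (fun x => Real.cos (m * (x - a))) x = -Real.sin (m * (x - a)) * m :=
    fun x => by
      have := (((hasDerivAt_id' x).sub_const a).const_mul m).cos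
      rw [this.deriv, mul_one]
  have hds : ∀ x, deriv (fun x => Real.sin (m * (x - a))) x = Real.cos (m * (x - a)) * m :=
    fun x => by
      have := (((hasDerivAt_id' x).sub_const a).const_mul m).sin
      rw [this.deriv, mul_one]
  have hi : ∀ {q : ℝ → ℝ} {w : ℝ → ℂ}, Continuous q → (∀ x, ‖q x‖ ≤ 1) →
      MemLp w 2 (volOn a b) → Integrable (fun x => q x • w x) (volOn a b) := by
    intro q w hq hq1 hw
    exact (hw.integrable (by norm_num)).bdd_smul 1 hq.aestronglyMeasurable
      (Eventually.of_forall hq1)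
  have hexp : ∀ w : ℝ → ℂ, MemLp w 2 (volOn a b) →
      ∫ x in Ioo a b, w x * Complex.exp (-Complex.I * m * (x - a))
      = (∫ x in Ioo a b, Real.cos (m * (x - a)) • w x)
        - Complex.I * ∫ x in Ioo a b, Real.sin (m * (x - a)) • w x := by
    intro w hw
    rw [← integral_const_mul, ← integral_sub]
    · refine integral_congr_ae (Eventually.of_forall fun x => ?_)
      simp only [Complex.real_smul]
      rw [show -Complex.I * m * (x - a) = ((-(m * (x - a)) : ℝ) : ℂ) * Complex.I by
        push_cast; ring, Complex.exp_mul_I, ← Complex.ofReal_cos, ← Complex.ofReal_sin,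
        Real.cos_neg, Real.sin_neg]
      push_cast
      ring
    · exact hi (by fun_prop) (fun x => Real.abs_cos_le_one _) hw
    · exact (hi (by fun_prop) (fun x => Real.abs_sin_le_one _) hw).const_mul _
  simp only [hdc, hds] at hc hs
  have hc' : (m : ℂ) * ∫ x in Ioo a b, Real.sin (m * (x - a)) • u x
      = ∫ x in Ioo a b, Real.cos (m * (x - a)) • v x := by
    rw [← neg_neg (∫ x in Ioo a b, Real.cos (m * (x - a)) • v x), ← hc, ← integral_const_mul,
      ← integral_neg]
    refine integral_congr_ae (Eventually.of_forall fun x => ?_)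
    simp only [Complex.real_smul]
    push_cast; ring
  have hs' : (m : ℂ) * ∫ x in Ioo a b, Real.cos (m * (x - a)) • u x
      = - ∫ x in Ioo a b, Real.sin (m * (x - a)) • v x := by
    rw [← hs, ← integral_const_mul]
    refine integral_congr_ae (Eventually.of_forall fun x => ?_)
    simp only [Complex.real_smul]
    push_cast; ring
  rw [fourierCoef_eq_setIntegral hab, fourierCoef_eq_setIntegral hab, hexp u hu, hexp v hv, ← hc',
    ← neg_neg (∫ x in Ioo a b, Real.sin (m * (x - a)) • v x), ← hs']
  ring_nf
  rw [Complex.I_sq]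
  ring

/-- A `C¹` function has its classical derivative as weak derivative. -/
theorem isWeakDeriv_of_hasDerivAt {a b : ℝ} (hab : a < b) {f f' : ℝ → ℂ}
    (hf : ∀ x, HasDerivAt f (f' x) x) (hf' : Continuous f') : IsWeakDeriv a b f f' := by
  intro φ h1 _ h3
  have hφa : φ a = 0 := image_eq_zero_of_notMem_tsupport fun h => lt_irrefl _ (h3 h).1
  have hφb : φ b = 0 := image_eq_zero_of_notMem_tsupport fun h => lt_irrefl _ (h3 h).2
  have hd : ∀ x, HasDerivAt φ (deriv φ x) x := fun x =>
    (h1.differentiable (by norm_num) x).hasDerivAt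
  have h := intervalIntegral.integral_smul_deriv_eq_deriv_smul (u := φ) (v := f) (u' := deriv φ)
    (v' := f') (a := a) (b := b) (fun x _ => hd x) (fun x _ => hf x)
    ((h1.continuous_deriv (by norm_num)).intervalIntegrable _ _) (hf'.intervalIntegrable _ _)
  rw [hφa, hφb, zero_smul, zero_smul, sub_self, zero_sub] at h
  simp only [intervalIntegral.integral_of_le hab.le, integral_Ioc_eq_integral_Ioo] at h
  rw [h, neg_neg]

/-! ### Norms of coefficient families and a discrete Gronwall inequality -/

/-- The Euclidean norm of the coefficients `c l`, `l ∈ s`. -/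
noncomputable def coefNorm (s : Finset ℤ) (c : ℤ → ℂ) : ℝ :=
  ‖(WithLp.toLp 2 (fun l : s => c l) : EuclideanSpace ℂ s)‖

theorem coefNorm_nonneg (s : Finset ℤ) (c : ℤ → ℂ) : 0 ≤ coefNorm s c := norm_nonneg _

theorem coefNorm_sq (s : Finset ℤ) (c : ℤ → ℂ) : coefNorm s c ^ 2 = ∑ l ∈ s, ‖c l‖ ^ 2 := by
  rw [coefNorm, EuclideanSpace.norm_sq_eq]
  exact Finset.sum_coe_sort s fun l => ‖c l‖ ^ 2

theorem coefNorm_add_le (s : Finset ℤ) (c d : ℤ → ℂ) :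
    coefNorm s (fun l => c l + d l) ≤ coefNorm s c + coefNorm s d :=
  norm_add_le (WithLp.toLp 2 (fun l : s => c l) : EuclideanSpace ℂ s)
    (WithLp.toLp 2 (fun l : s => d l))

theorem coefNorm_le_mul {s : Finset ℤ} {c d : ℤ → ℂ} {K : ℝ} (hK : 0 ≤ K)
    (h : ∀ l ∈ s, ‖c l‖ ≤ K * ‖d l‖) : coefNorm s c ≤ K * coefNorm s d := by
  refine le_of_sq_le_sq ?_ (mul_nonneg hK (coefNorm_nonneg s d))
  rw [mul_pow, coefNorm_sq, coefNorm_sq, Finset.mul_sum]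
  refine Finset.sum_le_sum fun l hl => ?_
  rw [← mul_pow]
  exact pow_le_pow_left₀ (norm_nonneg _) (h l hl) 2

theorem coefNorm_le {s : Finset ℤ} {c d : ℤ → ℂ} (h : ∀ l ∈ s, ‖c l‖ ≤ ‖d l‖) :
    coefNorm s c ≤ coefNorm s d := by
  simpa using coefNorm_le_mul zero_le_one (fun l hl => by simpa using h l hl)

theorem coefNorm_eq {s : Finset ℤ} {c d : ℤ → ℂ} (h : ∀ l ∈ s, ‖c l‖ = ‖d l‖) :
    coefNorm s c = coefNorm s d :=
  le_antisymm (coefNorm_le fun l hl => (h l hl).le) (coefNorm_le fun l hl => (h l hl).ge)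

theorem coefNorm_sub_le (s : Finset ℤ) (c d : ℤ → ℂ) :
    coefNorm s (fun l => c l - d l) ≤ coefNorm s c + coefNorm s d := by
  have h := coefNorm_add_le s c (fun l => -d l)
  rw [coefNorm_eq (c := fun l => -d l) (d := d) fun l _ => norm_neg _] at h
  simpa only [sub_eq_add_neg] using h

/-- The majorant is nondecreasing in the index, so both earlier terms may be replaced by its value
at `n + 1`. The index `j` is left free because the stability estimate uses `n - 1` and the error
estimate uses `n + 1`. -/
theorem two_step_gronwall {e : ℕ → ℝ} {A B m : ℝ} {n₀ : ℕ} (hA : 0 ≤ A) (hB : 0 ≤ B) (hm : 0 ≤ m)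
    (h0 : e 0 ≤ m) (h1 : 1 ≤ n₀ → e 1 ≤ m)
    (h : ∀ n, n + 2 ≤ n₀ → ∃ j ≤ n + 1, e (n + 2) ≤ e n + A * e j + B) :
    ∀ n ≤ n₀, e n ≤ (1 + A) ^ n * (m + B * n) := by
  have hmono : ∀ i j : ℕ, i ≤ j → (1 + A) ^ i * (m + B * i) ≤ (1 + A) ^ j * (m + B * j) := by
    intro i j hij
    have h3 : (1 : ℝ) ≤ 1 + A := by linarith
    have h4 : (i : ℝ) ≤ j := by exact_mod_cast hij
    gcongr
  intro n
  induction n using Nat.strong_induction_on with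
  | _ n ih =>
    intro hn
    match n, ih, hn with
    | 0, _, _ => simpa using h0
    | 1, _, hn =>
      have := h1 hn
      have h2 : 0 ≤ A * m := mul_nonneg hA hm
      have h3 : 0 ≤ A * B := mul_nonneg hA hB
      norm_num
      nlinarith
    | n + 2, ih, hn =>
      obtain ⟨j, hj, hle⟩ := h n hn
      have i1 := (ih n (by omega) (by omega)).trans (hmono n (n + 1) (by omega))
      have i2 := (ih j (by omega) (by omega)).trans (hmono j (n + 1) hj)
      have i3 := mul_le_mul_of_nonneg_left i2 hA
      have hp : (1 : ℝ) ≤ (1 + A) ^ (n + 2) := one_le_pow₀ (by linarith)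
      have hcast : ((n + 2 : ℕ) : ℝ) = ((n + 1 : ℕ) : ℝ) + 1 := by push_cast; ring
      calc e (n + 2) ≤ (1 + A) * ((1 + A) ^ (n + 1) * (m + B * (n + 1 : ℕ))) + B := by linarith
        _ = (1 + A) ^ (n + 2) * (m + B * (n + 1 : ℕ)) + B * 1 := by ring
        _ ≤ (1 + A) ^ (n + 2) * (m + B * (n + 1 : ℕ)) + B * (1 + A) ^ (n + 2) := by gcongr
        _ = (1 + A) ^ (n + 2) * (m + B * (n + 2 : ℕ)) := by rw [hcast]; ring

theorem one_add_pow_le_exp {A t : ℝ} (hA : 0 ≤ A) {n : ℕ} (h : A * n ≤ t) :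
    (1 + A) ^ n ≤ Real.exp t := by
  calc (1 + A) ^ n ≤ Real.exp A ^ n := by
        gcongr; rw [add_comm]; exact Real.add_one_le_exp A
    _ = Real.exp (A * n) := by rw [← Real.exp_nat_mul, mul_comm]
    _ ≤ Real.exp t := Real.exp_le_exp.2 h

/-! ### Duhamel's formula and the exponential integrator -/

/-- `r φ₁(i w r)` is the integral of `e^{i w s}` over `[0, r]`, that is, the exact response to a
constant forcing. -/
theorem hasDerivAt_mul_phi1 (w t : ℝ) :
    HasDerivAt (fun r : ℝ => (r : ℂ) * phi1 (Complex.I * w * r)) (Complex.exp (Complex.I * w * t))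
      t := by
  by_cases hw : w = 0
  · subst hw
    simpa [phi1] using (hasDerivAt_id' t).ofReal_comp
  · have hne : (Complex.I * w : ℂ) ≠ 0 :=
      mul_ne_zero Complex.I_ne_zero (Complex.ofReal_ne_zero.2 hw)
    have heq : (fun r : ℝ => (r : ℂ) * phi1 (Complex.I * w * r))
        = fun r : ℝ => (Complex.exp (Complex.I * w * r) - 1) / (Complex.I * w) := by
      funext r
      by_cases hr : r = 0
      · simp [hr]
      · have hr' : (r : ℂ) ≠ 0 := Complex.ofReal_ne_zero.2 hr
        rw [phi1, if_neg (mul_ne_zero hne hr')]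
        field_simp
    rw [heq]
    have h1 : HasDerivAt (fun r : ℝ => Complex.I * w * (r : ℂ)) (Complex.I * w * ((1 : ℝ) : ℂ)) t :=
      ((hasDerivAt_id' t).ofReal_comp).const_mul _
    have h2 := ((h1.cexp).sub_const 1).div_const (Complex.I * w)
    refine h2.congr_deriv ?_
    rw [Complex.ofReal_one, mul_one, mul_div_cancel_right₀ _ hne]

theorem norm_exp_I_mul (r t : ℝ) : ‖Complex.exp (Complex.I * r * t)‖ = 1 := by
  rw [show Complex.I * r * t = ((r * t : ℝ) : ℂ) * Complex.I by push_cast; ring]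
  exact Complex.norm_exp_ofReal_mul_I _

/-- Consistency of the exponential integrator: over `[p, q]`, freezing the forcing `g` of
`y' = -i ω y - i g` at time `r` causes an error of at most `(q - p) sup ‖g t - g r‖`. -/
theorem coefNorm_duhamel_le {s : Finset ℤ} {w : ℤ → ℝ} {y g : ℝ → ℤ → ℂ} {p q K : ℝ} (r : ℝ)
    (hpq : p < q) (hK : 0 ≤ K) (hc : ∀ l, ContinuousOn (fun t => y t l) (Icc p q))
    (hd : ∀ l, ∀ t ∈ Ioo p q, HasDerivAt (fun t => y t l)
      (-Complex.I * w l * y t l - Complex.I * g t l) t)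
    (hg : ∀ t ∈ Ioo p q, coefNorm s (fun l => g t l - g r l) ≤ K) :
    coefNorm s (fun l => y q l - (Complex.exp (Complex.I * w l * ((p - q : ℝ) : ℂ)) * y p l
      - Complex.I * Complex.exp (Complex.I * w l * ((r - q : ℝ) : ℂ))
        * (((q - r : ℝ) : ℂ) * phi1 (Complex.I * w l * ((q - r : ℝ) : ℂ))
          - ((p - r : ℝ) : ℂ) * phi1 (Complex.I * w l * ((p - r : ℝ) : ℂ))) * g r l))
      ≤ K * (q - p) := by
  lift K to NNReal using hK
  -- The solution in the rotating frame based at `r`, corrected by the exact response to the frozen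
  -- forcing. Its derivative is a unit phase times `g t - g r`, so the mean value inequality gives
  -- the claim.
  set D : ℝ → ℤ → ℂ := fun t l => Complex.exp (Complex.I * w l * ((t - r : ℝ) : ℂ)) * y t l
    + Complex.I * (((t - r : ℝ) : ℂ) * phi1 (Complex.I * w l * ((t - r : ℝ) : ℂ))) * g r l with hD
  have hJ : ∀ l t, HasDerivAt (fun t : ℝ => ((t - r : ℝ) : ℂ) *
      phi1 (Complex.I * w l * ((t - r : ℝ) : ℂ)))
      (Complex.exp (Complex.I * w l * ((t - r : ℝ) : ℂ))) t := fun l t => by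
    have h := (hasDerivAt_mul_phi1 (w l) (t - r)).scomp t ((hasDerivAt_id' t).sub_const r)
    rw [one_smul] at h
    exact h
  have hE : ∀ l t, HasDerivAt (fun t : ℝ => Complex.exp (Complex.I * w l * ((t - r : ℝ) : ℂ)))
      (Complex.exp (Complex.I * w l * ((t - r : ℝ) : ℂ)) * (Complex.I * w l)) t := fun l t => by
    have h1 : HasDerivAt (fun t : ℝ => Complex.I * w l * ((t - r : ℝ) : ℂ))
        (Complex.I * w l * ((1 : ℝ) : ℂ)) t :=
      (((hasDerivAt_id t).sub_const r).ofReal_comp).const_mul _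
    simpa using h1.cexp
  have hDd : ∀ l, ∀ t ∈ Ioo p q, HasDerivAt (fun t => D t l)
      (-Complex.I * Complex.exp (Complex.I * w l * ((t - r : ℝ) : ℂ)) * (g t l - g r l)) t := by
    intro l t ht
    have h := ((hE l t).mul (hd l t ht)).add (((hJ l t).const_mul Complex.I).mul_const (g r l))
    exact h.congr_deriv (by ring)
  have hDc : ∀ l, ContinuousOn (fun t => D t l) (Icc p q) := fun l =>
    ((continuous_iff_continuousAt.2 fun t => (hE l t).continuousAt).continuousOn.mul (hc l)).add
      (continuous_iff_continuousAt.2 fun t =>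
        (((hJ l t).const_mul Complex.I).mul_const (g r l)).continuousAt).continuousOn
  let Φ : ℝ → EuclideanSpace ℂ s := fun t => WithLp.toLp 2 (fun l : s => D t l)
  have hΦd : ∀ t ∈ Ioo p q, HasDerivAt Φ (WithLp.toLp 2 (fun l : s => -Complex.I *
      Complex.exp (Complex.I * w l * ((t - r : ℝ) : ℂ)) * (g t l - g r l))) t := by
    intro t ht
    exact (PiLp.continuousLinearEquiv 2 ℝ (fun _ : s => ℂ)).symm.hasFDerivAt.comp_hasDerivAt t
      (hasDerivAt_pi.2 fun l : s => hDd l t ht)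
  have hΦc : ContinuousOn Φ (Icc p q) :=
    (PiLp.continuous_toLp 2 _).comp_continuousOn (continuousOn_pi.2 fun l : s => hDc l)
  have hlip : LipschitzOnWith K Φ (Ioo p q) := by
    refine (convex_Ioo p q).lipschitzOnWith_of_nnnorm_hasDerivWithin_le
      (fun t ht => (hΦd t ht).hasDerivWithinAt) fun t ht => ?_
    rw [← NNReal.coe_le_coe]
    refine le_trans (le_of_eq ?_) (hg t ht)
    refine coefNorm_eq (c := fun l => -Complex.I *
      Complex.exp (Complex.I * w l * ((t - r : ℝ) : ℂ)) * (g t l - g r l)) fun l _ => ?_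
    rw [norm_mul, norm_mul, norm_neg, Complex.norm_I, norm_exp_I_mul, one_mul, one_mul]
  -- The equation holds only in the open interval; continuity carries the Lipschitz bound to the
  -- endpoints.
  have hlip2 : LipschitzOnWith K Φ (Icc p q) := by
    rw [← closure_Ioo hpq.ne] at hΦc ⊢
    exact hlip.closure hΦc
  have hfin := hlip2.dist_le_mul q (right_mem_Icc.2 hpq.le) p (left_mem_Icc.2 hpq.le)
  rw [dist_eq_norm, Real.dist_eq, abs_of_pos (sub_pos.2 hpq)] at hfin
  refine le_trans (le_of_eq ?_) hfin
  refine (coefNorm_eq (d := fun l => D q l - D p l) fun l _ => ?_)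
  have hq : Complex.exp (Complex.I * w l * ((r - q : ℝ) : ℂ)) *
      Complex.exp (Complex.I * w l * ((q - r : ℝ) : ℂ)) = 1 := by
    rw [← Complex.exp_add, ← Complex.exp_zero]; congr 1; push_cast; ring
  have hp : Complex.exp (Complex.I * w l * ((r - q : ℝ) : ℂ)) *
      Complex.exp (Complex.I * w l * ((p - r : ℝ) : ℂ))
      = Complex.exp (Complex.I * w l * ((p - q : ℝ) : ℂ)) := by
    rw [← Complex.exp_add]; congr 1; push_cast; ring
  have h1 := norm_exp_I_mul (w l) (r - q)
  rw [← one_mul ‖D q l - D p l‖, ← h1, ← norm_mul]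
  congr 1
  rw [← hp]
  simp only [hD]
  linear_combination (-y q l) * hq

/-- Identifies the Duhamel weight for forcing frozen at the left end with that of the first step of
the scheme. -/
theorem exp_mul_phi1 (w t : ℝ) :
    Complex.exp (Complex.I * w * ((-t : ℝ) : ℂ)) * ((t : ℂ) * phi1 (Complex.I * w * t))
      = t * phi1 (-Complex.I * t * w) := by
  by_cases h : (Complex.I * w * t : ℂ) = 0
  · have h2 : (-Complex.I * t * w : ℂ) = 0 := by linear_combination -h
    rw [show (Complex.I * w * ((-t : ℝ) : ℂ)) = 0 by push_cast; linear_combination -h, h, h2]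
    simp [phi1]
  · have h2 : (-Complex.I * t * w : ℂ) ≠ 0 := fun h3 => h (by linear_combination -h3)
    rw [phi1, phi1, if_neg h, if_neg h2, show (Complex.I * w * ((-t : ℝ) : ℂ)) = -(Complex.I * w * t)
      by push_cast; ring, show (-Complex.I * t * w : ℂ) = -(Complex.I * w * t) by ring,
      div_neg, mul_left_comm, ← mul_div_assoc, mul_sub, ← Complex.exp_add]
    simp only [neg_add_cancel, Complex.exp_zero, mul_one]
    ring

/-- Both sides are the integral of `e^{i w s}` over `[-t, t]`: freezing at the midpoint produces the
`sinc` filter. -/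
theorem mul_phi1_sub_mul_phi1_neg (w t : ℝ) :
    (t : ℂ) * phi1 (Complex.I * w * t) - ((-t : ℝ) : ℂ) * phi1 (Complex.I * w * ((-t : ℝ) : ℂ))
      = 2 * t * (Real.sinc (t * w) : ℂ) := by
  by_cases h : t * w = 0
  · have h1 : (Complex.I * w * t : ℂ) = 0 := by
      have : ((t * w : ℝ) : ℂ) = 0 := by rw [h, Complex.ofReal_zero]
      push_cast at this; linear_combination Complex.I * this
    rw [show (Complex.I * w * ((-t : ℝ) : ℂ)) = 0 by push_cast; linear_combination -h1, h1, h]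
    simp [phi1]; ring
  · have ht : (t : ℂ) ≠ 0 := Complex.ofReal_ne_zero.2 (left_ne_zero_of_mul h)
    have hw : (w : ℂ) ≠ 0 := Complex.ofReal_ne_zero.2 (right_ne_zero_of_mul h)
    have h1 : (Complex.I * w * t : ℂ) ≠ 0 := mul_ne_zero (mul_ne_zero Complex.I_ne_zero hw) ht
    have h2 : (Complex.I * w * ((-t : ℝ) : ℂ)) = -(Complex.I * w * t) := by push_cast; ring
    rw [phi1, phi1, h2, if_neg h1, if_neg (neg_ne_zero.2 h1), Real.sinc_of_ne_zero h]
    push_cast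
    rw [Complex.sin, show -((t : ℂ) * w) * Complex.I = -(Complex.I * w * t) by ring,
      show (t : ℂ) * w * Complex.I = Complex.I * w * t by ring]
    field_simp
    ring_nf
    simp only [Complex.I_sq]
    ring

/-! ### Local Lipschitz continuity of the nonlinearity -/

/-- Bernoulli's inequality for the exponent `p + 1` at `y / x`. The extra factor `y` makes the bound
valid for every `p > 0`, including `p < 1`, where the power itself is not Lipschitz at `0`. -/
theorem rpow_sub_rpow_mul_le {p x y : ℝ} (hp : 0 < p) (hy : 0 ≤ y) (hyx : y ≤ x) :
    (x ^ p - y ^ p) * y ≤ p * x ^ p * (x - y) := by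
  rcases hy.eq_or_lt with rfl | hy
  · have := mul_nonneg (mul_nonneg hp.le (Real.rpow_nonneg hyx p)) hyx
    simpa using this
  · have hx : 0 < x := hy.trans_le hyx
    have h := one_add_mul_self_le_rpow_one_add (s := y / x - 1) (p := p + 1)
      (by have := div_nonneg hy.le hx.le; linarith) (by linarith)
    rw [add_sub_cancel, Real.div_rpow hy.le hx.le, le_div_iff₀ (by positivity),
      Real.rpow_add_one hx.ne', Real.rpow_add_one hy.ne'] at h
    have h2 : (1 + (p + 1) * (y / x - 1)) * (x ^ p * x) = x ^ p * x + (p + 1) * x ^ p * (y - x) := by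
      field_simp
    rw [h2] at h
    linarith

theorem norm_rpow_smul_sub_le_of_le {p M : ℝ} (hp : 0 < p) {z w : ℂ} (hz : ‖z‖ ≤ M)
    (hwz : ‖w‖ ≤ ‖z‖) :
    ‖((‖z‖ ^ p : ℝ) : ℂ) * z - ((‖w‖ ^ p : ℝ) : ℂ) * w‖ ≤ (p + 1) * M ^ p * ‖z - w‖ := by
  -- The difference of powers is paired with `w`, the entry of smaller modulus, as the preceding
  -- inequality requires.
  have h1 : ((‖z‖ ^ p : ℝ) : ℂ) * z - ((‖w‖ ^ p : ℝ) : ℂ) * w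
      = ((‖z‖ ^ p : ℝ) : ℂ) * (z - w) + ((‖z‖ ^ p - ‖w‖ ^ p : ℝ) : ℂ) * w := by
    push_cast; ring
  have h2 : 0 ≤ ‖z‖ ^ p - ‖w‖ ^ p :=
    sub_nonneg.2 (Real.rpow_le_rpow (norm_nonneg _) hwz hp.le)
  have h3 := rpow_sub_rpow_mul_le hp (norm_nonneg w) hwz
  have h4 : ‖z‖ - ‖w‖ ≤ ‖z - w‖ := norm_sub_norm_le z w
  have h5 : ‖z‖ ^ p ≤ M ^ p := Real.rpow_le_rpow (norm_nonneg _) hz hp.le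
  have h6 : 0 ≤ ‖z‖ ^ p := Real.rpow_nonneg (norm_nonneg _) _
  rw [h1]
  refine (norm_add_le _ _).trans ?_
  rw [norm_mul, norm_mul, Complex.norm_real, Complex.norm_real, Real.norm_of_nonneg h6,
    Real.norm_of_nonneg h2]
  calc ‖z‖ ^ p * ‖z - w‖ + (‖z‖ ^ p - ‖w‖ ^ p) * ‖w‖
      ≤ ‖z‖ ^ p * ‖z - w‖ + p * ‖z‖ ^ p * (‖z‖ - ‖w‖) := by linarith
    _ ≤ ‖z‖ ^ p * ‖z - w‖ + p * ‖z‖ ^ p * ‖z - w‖ := by gcongr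
    _ = (p + 1) * ‖z‖ ^ p * ‖z - w‖ := by ring
    _ ≤ (p + 1) * M ^ p * ‖z - w‖ := by gcongr

theorem norm_rpow_smul_sub_le {p M : ℝ} (hp : 0 < p) {z w : ℂ} (hz : ‖z‖ ≤ M) (hw : ‖w‖ ≤ M) :
    ‖((‖z‖ ^ p : ℝ) : ℂ) * z - ((‖w‖ ^ p : ℝ) : ℂ) * w‖ ≤ (p + 1) * M ^ p * ‖z - w‖ := by
  rcases le_total ‖w‖ ‖z‖ with h | h
  · exact norm_rpow_smul_sub_le_of_le hp hz h
  · rw [norm_sub_rev, norm_sub_rev z w]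
    exact norm_rpow_smul_sub_le_of_le hp hw h

/-- A Lipschitz constant of `opB` on functions bounded by `M`. -/
noncomputable def lipB (a b : ℝ) (V : ℝ → ℝ) (β σ M : ℝ) : ℝ :=
  (eLpNorm V ∞ (volOn a b)).toReal + |β| * ((2 * σ + 1) * M ^ (2 * σ))

theorem lipB_nonneg {a b : ℝ} {V : ℝ → ℝ} {β σ M : ℝ} (hσ : 0 < σ) (hM : 0 ≤ M) :
    0 ≤ lipB a b V β σ M := by
  unfold lipB
  positivity

theorem ae_norm_opB_sub_le {a b : ℝ} {V : ℝ → ℝ} {β σ M : ℝ} (hσ : 0 < σ)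
    (hV : MemLp V ∞ (volOn a b)) {u v : ℝ → ℂ} (hu : ∀ᵐ x ∂(volOn a b), ‖u x‖ ≤ M)
    (hv : ∀ᵐ x ∂(volOn a b), ‖v x‖ ≤ M) :
    ∀ᵐ x ∂(volOn a b), ‖opB V β σ u x - opB V β σ v x‖ ≤ lipB a b V β σ M * ‖u x - v x‖ := by
  have hVb : ∀ᵐ x ∂(volOn a b), ‖V x‖ ≤ (eLpNorm V ∞ (volOn a b)).toReal := by
    have h := ae_le_eLpNormEssSup (f := V) (μ := volOn a b)
    filter_upwards [h] with x hx
    rw [eLpNorm_exponent_top]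
    have hfin : eLpNormEssSup V (volOn a b) ≠ ⊤ := by
      rw [← eLpNorm_exponent_top]; exact hV.2.ne
    simpa using ENNReal.toReal_mono hfin hx
  filter_upwards [hu, hv, hVb] with x h1 h2 h3
  have hrw : ∀ z : ℂ, ((β * (‖z‖ ^ 2) ^ σ : ℝ) : ℂ) * z
      = (β : ℂ) * (((‖z‖ ^ (2 * σ) : ℝ) : ℂ) * z) := fun z => by
    rw [← Real.rpow_natCast, ← Real.rpow_mul (norm_nonneg z)]
    push_cast; ring
  have heq : opB V β σ u x - opB V β σ v x = (V x : ℂ) * (u x - v x)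
      + (β : ℂ) * (((‖u x‖ ^ (2 * σ) : ℝ) : ℂ) * u x - ((‖v x‖ ^ (2 * σ) : ℝ) : ℂ) * v x) := by
    simp only [opB, hrw]; ring
  rw [heq, lipB, add_mul]
  refine (norm_add_le _ _).trans ?_
  rw [norm_mul, norm_mul, Complex.norm_real, Complex.norm_real, Real.norm_eq_abs β, mul_assoc |β|]
  have h4 := norm_rpow_smul_sub_le (p := 2 * σ) (by positivity) h1 h2
  gcongr

/-- Makes size bounds for `opB` a special case of Lipschitz bounds. -/
theorem opB_zero (V : ℝ → ℝ) (β σ : ℝ) : opB V β σ (fun _ => 0) = fun _ => 0 := by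
  funext x; simp [opB]

theorem aestronglyMeasurable_opB {a b : ℝ} {V : ℝ → ℝ} {β σ : ℝ} (hσ : 0 < σ)
    (hV : MemLp V ∞ (volOn a b)) {u : ℝ → ℂ} (hu : AEStronglyMeasurable u (volOn a b)) :
    AEStronglyMeasurable (opB V β σ u) (volOn a b) := by
  have hc : Continuous fun z : ℂ => ((β * (‖z‖ ^ 2) ^ σ : ℝ) : ℂ) * z := by
    refine (Complex.continuous_ofReal.comp (continuous_const.mul ?_)).mul continuous_id
    exact (continuous_norm.pow 2).rpow_const fun _ => Or.inr hσ.le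
  exact ((Complex.continuous_ofReal.comp_aestronglyMeasurable hV.1).mul hu).add
    (hc.comp_aestronglyMeasurable hu)

theorem memLp_opB {a b : ℝ} {V : ℝ → ℝ} {β σ M : ℝ} (hσ : 0 < σ) (hM : 0 ≤ M)
    (hV : MemLp V ∞ (volOn a b)) {u : ℝ → ℂ} (hu : MemLp u 2 (volOn a b))
    (hb : ∀ᵐ x ∂(volOn a b), ‖u x‖ ≤ M) : MemLp (opB V β σ u) 2 (volOn a b) := by
  refine MemLp.of_le_mul (c := lipB a b V β σ M) hu (aestronglyMeasurable_opB hσ hV hu.1) ?_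
  have h := ae_norm_opB_sub_le (β := β) hσ hV hb
    (v := fun _ => 0) (Eventually.of_forall fun _ => by simpa using hM)
  simpa [opB_zero] using h

theorem sum_sq_fourierCoef_le {a b : ℝ} (hab : a < b) {f : ℝ → ℂ} (hf : MemLp f 2 (volOn a b))
    (s : Finset ℤ) : ∑ l ∈ s, ‖fourierCoef a b f l‖ ^ 2 ≤ (b - a)⁻¹ * ∫ x in Ioo a b, ‖f x‖ ^ 2 :=
  sum_le_hasSum s (fun _ _ => by positivity) (hasSum_sq_fourierCoef hab hf)

/-- Lipschitz continuity of `opB` at the level of Fourier coefficients. -/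
theorem coefNorm_fourierCoef_opB_sub_le {a b : ℝ} (hab : a < b) {V : ℝ → ℝ} {β σ M D : ℝ}
    (hσ : 0 < σ) (hM : 0 ≤ M) (hD : 0 ≤ D)
    (hV : MemLp V ∞ (volOn a b)) {u v : ℝ → ℂ} (hu : MemLp u 2 (volOn a b))
    (hv : MemLp v 2 (volOn a b)) (hub : ∀ᵐ x ∂(volOn a b), ‖u x‖ ≤ M)
    (hvb : ∀ᵐ x ∂(volOn a b), ‖v x‖ ≤ M) (s : Finset ℤ)
    (h : ∀ r : Finset ℤ, ∑ l ∈ r, ‖fourierCoef a b u l - fourierCoef a b v l‖ ^ 2 ≤ D ^ 2) :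
    coefNorm s (fun l => fourierCoef a b (opB V β σ u) l - fourierCoef a b (opB V β σ v) l)
      ≤ lipB a b V β σ M * D := by
  have hL := lipB_nonneg (a := a) (b := b) (V := V) (β := β) hσ hM
  have hBu := memLp_opB (β := β) hσ hM hV hu hub
  have hBv := memLp_opB (β := β) hσ hM hV hv hvb
  refine le_of_sq_le_sq ?_ (mul_nonneg hL hD)
  rw [coefNorm_sq]
  simp only [← fourierCoef_sub hab hBu hBv]
  refine (sum_sq_fourierCoef_le hab (hBu.sub hBv) s).trans ?_
  have hsum := hasSum_sq_fourierCoef hab (hu.sub hv)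
  -- `opB` mixes all modes, so the full `L²` distance is needed; this is why `h` ranges over all
  -- finite sets and not only over `s`.
  have hint : (b - a)⁻¹ * ∫ x in Ioo a b, ‖u x - v x‖ ^ 2 ≤ D ^ 2 := by
    refine hasSum_le_of_sum_le hsum fun r => ?_
    refine le_trans (le_of_eq (Finset.sum_congr rfl fun l _ => ?_)) (h r)
    rw [← fourierCoef_sub hab hu hv]; rfl
  have hle : ∫ x in Ioo a b, ‖opB V β σ u x - opB V β σ v x‖ ^ 2
      ≤ lipB a b V β σ M ^ 2 * ∫ x in Ioo a b, ‖u x - v x‖ ^ 2 := by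
    rw [← integral_const_mul]
    refine integral_mono_ae ((hBu.sub hBv).integrable_norm_pow (by norm_num))
      (((hu.sub hv).integrable_norm_pow (by norm_num)).const_mul _) ?_
    filter_upwards [ae_norm_opB_sub_le (β := β) hσ hV hub hvb] with x hx
    rw [← mul_pow]
    exact pow_le_pow_left₀ (norm_nonneg _) hx 2
  have hba : 0 ≤ (b - a)⁻¹ := inv_nonneg.2 (sub_pos.2 hab).le
  calc _ ≤ (b - a)⁻¹ * (lipB a b V β σ M ^ 2 * ∫ x in Ioo a b, ‖u x - v x‖ ^ 2) :=
        mul_le_mul_of_nonneg_left hle hba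
    _ = lipB a b V β σ M ^ 2 * ((b - a)⁻¹ * ∫ x in Ioo a b, ‖u x - v x‖ ^ 2) := by ring
    _ ≤ lipB a b V β σ M ^ 2 * D ^ 2 := by gcongr
    _ = _ := by ring

/-! ### Sobolev embedding, interpolation and truncation on the Fourier side -/

theorem exists_sum_inv_one_add_freq_sq_le {a b : ℝ} (hab : a < b) :
    ∃ S : ℝ, 0 < S ∧ ∀ s : Finset ℤ, ∑ l ∈ s, 1 / (1 + freq a b l ^ 2) ≤ S := by
  have hba : 0 < b - a := sub_pos.2 hab
  set c : ℝ := 2 * Real.pi / (b - a) with hc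
  have hc0 : 0 < c := by positivity
  have hf : ∀ l : ℤ, freq a b l = c * l := fun l => by rw [freq, hc]; ring
  have hs : Summable fun l : ℤ => 1 / (l : ℝ) ^ 2 := Real.summable_one_div_int_pow.2 (by norm_num)
  -- The mode `l = 0` is counted separately, because `1 / 0 ^ 2` is `0` in Lean.
  have hle : ∀ l : ℤ, 1 / (1 + freq a b l ^ 2)
      ≤ (if l = 0 then (1 : ℝ) else 0) + (1 / c ^ 2) * (1 / (l : ℝ) ^ 2) := by
    intro l
    rw [hf]
    split_ifs with h
    · subst h; simp
    · have hl : (0 : ℝ) < (l : ℝ) ^ 2 := by positivity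
      rw [zero_add, one_div_mul_one_div, mul_pow]
      exact one_div_le_one_div_of_le (by positivity) (by linarith)
  refine ⟨1 + (1 / c ^ 2) * ∑' l : ℤ, 1 / (l : ℝ) ^ 2, ?_, fun s => ?_⟩
  · have : 0 ≤ ∑' l : ℤ, 1 / (l : ℝ) ^ 2 := tsum_nonneg fun _ => by positivity
    positivity
  · refine (Finset.sum_le_sum fun l _ => hle l).trans ?_
    rw [Finset.sum_add_distrib, ← Finset.mul_sum]
    have h1 : ∑ l ∈ s, (if l = 0 then (1 : ℝ) else 0) ≤ 1 := by
      rw [Finset.sum_ite_eq']; split_ifs <;> norm_num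
    have h2 : ∑ l ∈ s, 1 / (l : ℝ) ^ 2 ≤ ∑' l : ℤ, 1 / (l : ℝ) ^ 2 :=
      hs.sum_le_tsum s fun _ _ => by positivity
    gcongr

/-- Cauchy–Schwarz with weights `1 + μ²`: the one-dimensional embedding of `H¹` into absolutely
convergent Fourier series. -/
theorem sum_norm_sq_le {a b S : ℝ} (hS : ∀ s : Finset ℤ, ∑ l ∈ s, 1 / (1 + freq a b l ^ 2) ≤ S)
    (c : ℤ → ℂ) (s : Finset ℤ) :
    (∑ l ∈ s, ‖c l‖) ^ 2 ≤ S * ∑ l ∈ s, (1 + freq a b l ^ 2) * ‖c l‖ ^ 2 := by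
  have h := Finset.sum_sq_le_sum_mul_sum_of_sq_le_mul s (r := fun l => ‖c l‖)
    (f := fun l => 1 / (1 + freq a b l ^ 2)) (g := fun l => (1 + freq a b l ^ 2) * ‖c l‖ ^ 2)
    (fun l _ => by positivity) (fun l _ => by positivity)
    (fun l _ => by have : (1 + freq a b l ^ 2) ≠ 0 := by positivity
                   refine le_of_eq ?_
                   field_simp)
  exact h.trans (mul_le_mul_of_nonneg_right (hS s) (Finset.sum_nonneg fun l _ => by positivity))

/-- Interpolation between `L²` and `H²`. -/
theorem sum_freq_sq_mul_le {a b ε C : ℝ} (hε : 0 < ε) {c : ℤ → ℂ} {s : Finset ℤ}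
    (h0 : ∑ l ∈ s, ‖c l‖ ^ 2 ≤ (C * ε) ^ 2) (h2 : ∑ l ∈ s, (freq a b l ^ 2 * ‖c l‖) ^ 2 ≤ C ^ 2) :
    ∑ l ∈ s, freq a b l ^ 2 * ‖c l‖ ^ 2 ≤ C ^ 2 * ε := by
  -- Young's inequality weighted by `ε`, so that each term contributes `C ^ 2 * ε / 2`.
  have h : ∀ l ∈ s, freq a b l ^ 2 * ‖c l‖ ^ 2
      ≤ 1 / (2 * ε) * ‖c l‖ ^ 2 + ε / 2 * (freq a b l ^ 2 * ‖c l‖) ^ 2 := by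
    intro l _
    have h3 := sq_nonneg (‖c l‖ - ε * (freq a b l ^ 2 * ‖c l‖))
    have h4 : 0 ≤ 1 / (2 * ε) * (‖c l‖ - ε * (freq a b l ^ 2 * ‖c l‖)) ^ 2 := by positivity
    have h5 : 1 / (2 * ε) * (‖c l‖ - ε * (freq a b l ^ 2 * ‖c l‖)) ^ 2
      = 1 / (2 * ε) * ‖c l‖ ^ 2 + ε / 2 * (freq a b l ^ 2 * ‖c l‖) ^ 2
        - freq a b l ^ 2 * ‖c l‖ ^ 2 := by field_simp; ring
    linarith
  refine (Finset.sum_le_sum h).trans ?_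
  rw [Finset.sum_add_distrib, ← Finset.mul_sum, ← Finset.mul_sum]
  calc _ ≤ 1 / (2 * ε) * (C * ε) ^ 2 + ε / 2 * C ^ 2 := by gcongr
    _ = C ^ 2 * ε := by field_simp; ring

/-- For `N` even, a mode outside the index set has `|l| ≥ N / 2`, so `h |μ_l| = 2π|l| / N ≥ π`. Each
factor `μ²` thus buys a factor `h²` on the truncated modes. -/
theorem one_le_sq_mul_freq_sq {a b h : ℝ} (hab : a < b) {N : ℕ} (hN : 0 < N) (hE : Even N)
    (hh : h = (b - a) / N) {l : ℤ} (hl : l ∉ indexSet N) : 1 ≤ h ^ 2 * freq a b l ^ 2 := by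
  obtain ⟨k, rfl⟩ := hE
  have hba : 0 < b - a := sub_pos.2 hab
  have hk : 0 < k := by omega
  have hkl : (k : ℤ) ≤ |l| := by
    rw [mem_indexSet] at hl
    push_cast at hl
    rw [le_abs]
    omega
  have hkl' : (k : ℝ) ≤ |(l : ℝ)| := by exact_mod_cast hkl
  have hk' : (0 : ℝ) < k := by exact_mod_cast hk
  have h1 : h * freq a b l = Real.pi * (l / k) := by
    rw [hh, freq]; push_cast; field_simp; ring
  have h2 : 1 ≤ |h * freq a b l| := by
    rw [h1, abs_mul, abs_div, abs_of_pos hk', abs_of_pos Real.pi_pos]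
    have h3 : 1 ≤ |(l : ℝ)| / k := by rwa [one_le_div hk']
    have h4 : (1 : ℝ) ≤ Real.pi := by linarith [Real.pi_gt_three]
    nlinarith
  rw [← mul_pow, ← sq_abs]
  exact one_le_pow₀ h2

/-! ### The exact solution on the Fourier side -/

theorem norm_wderiv_le {a b : ℝ} {m : ℕ} (w : Sobolev a b m) (k : Fin (m + 1)) :
    ‖wderiv w k‖ ≤ ‖w‖ :=
  PiLp.norm_apply_le (w : PiLp 2 (fun _ : Fin (m + 1) => L2 a b)) k

theorem IsPeriodic.fourierCoef_wderiv_succ {a b : ℝ} (hab : a < b) {m : ℕ} {w : Sobolev a b m}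
    (hw : IsPeriodic w) (k : Fin m) (l : ℤ) :
    fourierCoef a b (wderiv w k.succ) l
      = Complex.I * freq a b l * fourierCoef a b (wderiv w k.castSucc) l := by
  obtain ⟨g, hg, hug, hgab⟩ := hw k
  exact IsWeakDeriv.fourierCoef hab (Lp.memLp _) (Lp.memLp _) (w.2 k) hg hug hgab l

theorem IsPeriodic.fourierCoef_wderiv_one {a b : ℝ} (hab : a < b) {w : Sobolev a b 2}
    (hw : IsPeriodic w) (l : ℤ) :
    fourierCoef a b (wderiv w 1) l = Complex.I * freq a b l * fourierCoef a b (wderiv w 0) l :=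
  hw.fourierCoef_wderiv_succ hab 0 l

theorem IsPeriodic.fourierCoef_wderiv_two {a b : ℝ} (hab : a < b) {w : Sobolev a b 2}
    (hw : IsPeriodic w) (l : ℤ) :
    fourierCoef a b (wderiv w 2) l = -((freq a b l ^ 2 : ℝ) : ℂ) * fourierCoef a b (wderiv w 0) l := by
  have h := hw.fourierCoef_wderiv_succ hab 1 l
  have h1 := hw.fourierCoef_wderiv_one hab l
  have h2 : fourierCoef a b (wderiv w 2) l
      = Complex.I * freq a b l * fourierCoef a b (wderiv w 1) l := h
  rw [h2, h1]
  push_cast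
  linear_combination (freq a b l : ℂ) ^ 2 * fourierCoef a b (wderiv w 0) l * Complex.I_sq

theorem sum_sq_fourierCoef_L2_le {a b : ℝ} (hab : a < b) (f : L2 a b) (s : Finset ℤ) :
    ∑ l ∈ s, ‖fourierCoef a b f l‖ ^ 2 ≤ (b - a)⁻¹ * ‖f‖ ^ 2 :=
  sum_le_hasSum s (fun _ _ => by positivity) (hasSum_sq_fourierCoef_L2 hab f)

theorem fourierCoef_L2_sub {a b : ℝ} (hab : a < b) (f g : L2 a b) (l : ℤ) :
    fourierCoef a b (f - g : L2 a b) l = fourierCoef a b f l - fourierCoef a b g l :=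
  (fourierCoefL a b hab l).map_sub f g

/-- Uniform bounds for the Fourier coefficients of the exact solution. -/
theorem IsNLSSolution.exists_bound {a b T β σ : ℝ} (hab : a < b) {V : ℝ → ℝ} {ψ₀ : ℝ → ℂ}
    {ψ : ℝ → Sobolev a b 2} (hψ : IsNLSSolution a b T V β σ ψ₀ ψ) :
    ∃ K : ℝ, 0 < K ∧ ∀ t ∈ Icc 0 T, ∀ s : Finset ℤ,
      ∑ l ∈ s, ‖fourierCoef a b (wderiv (ψ t) 0) l‖ ^ 2 ≤ K ^ 2 ∧
      ∑ l ∈ s, (freq a b l ^ 2 * ‖fourierCoef a b (wderiv (ψ t) 0) l‖) ^ 2 ≤ K ^ 2 ∧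
      ∑ l ∈ s, ‖fourierCoef a b (wderiv (ψ t) 0) l‖ ≤ K ∧
      ∀ t' ∈ Icc 0 T, ∑ l ∈ s, ‖fourierCoef a b (wderiv (ψ t) 0) l
        - fourierCoef a b (wderiv (ψ t') 0) l‖ ^ 2 ≤ (K * |t - t'|) ^ 2 := by
  have hba : 0 < (b - a)⁻¹ := inv_pos.2 (sub_pos.2 hab)
  obtain ⟨R, hR⟩ := isCompact_Icc.exists_bound_of_continuousOn hψ.continuousOn
  obtain ⟨Q, hQ⟩ := hψ.contDiffOn.exists_lipschitzOnWith (by norm_num) (convex_Icc 0 T)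
    isCompact_Icc
  obtain ⟨S, hS0, hS⟩ := exists_sum_inv_one_add_freq_sq_le hab
  set q := Real.sqrt (b - a)⁻¹ with hq
  have hq0 : 0 < q := Real.sqrt_pos.2 hba
  have hq2 : q ^ 2 = (b - a)⁻¹ := Real.sq_sqrt hba.le
  set R' := max R 0 with hR'
  have hR'0 : 0 ≤ R' := le_max_right _ _
  -- One summand each for the `L²` and `H²` sizes, the Lipschitz constant in time and the absolute
  -- sum of coefficients; `q` is the Parseval factor and the `1` ensures positivity.
  set K := q * R' + q * Q + Real.sqrt (2 * S) * (q * R') + 1 with hK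
  have hsq0 := Real.sqrt_nonneg (2 * S)
  have hQ0 : (0 : ℝ) ≤ Q := Q.2
  have t1 : 0 ≤ q * R' := by positivity
  have t2 : 0 ≤ q * Q := by positivity
  have t3 : 0 ≤ Real.sqrt (2 * S) * (q * R') := by positivity
  refine ⟨K, by positivity, fun t ht s => ?_⟩
  have hk : ∀ k, ∑ l ∈ s, ‖fourierCoef a b (wderiv (ψ t) k) l‖ ^ 2 ≤ (q * R') ^ 2 := fun k => by
    refine (sum_sq_fourierCoef_L2_le hab _ s).trans ?_
    rw [mul_pow, hq2]
    have h1 : ‖wderiv (ψ t) k‖ ≤ R' :=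
      (norm_wderiv_le _ _).trans ((hR t ht).trans (le_max_left _ _))
    gcongr
  have h0 := hk 0
  have h2 : ∑ l ∈ s, (freq a b l ^ 2 * ‖fourierCoef a b (wderiv (ψ t) 0) l‖) ^ 2
      ≤ (q * R') ^ 2 := by
    refine le_trans (le_of_eq (Finset.sum_congr rfl fun l _ => ?_)) (hk 2)
    rw [(hψ.periodic t ht).fourierCoef_wderiv_two hab, norm_mul, norm_neg, Complex.norm_real,
      Real.norm_of_nonneg (sq_nonneg _)]
  have h1 : ∑ l ∈ s, freq a b l ^ 2 * ‖fourierCoef a b (wderiv (ψ t) 0) l‖ ^ 2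
      ≤ (q * R') ^ 2 := by
    refine le_trans (le_of_eq (Finset.sum_congr rfl fun l _ => ?_)) (hk 1)
    rw [(hψ.periodic t ht).fourierCoef_wderiv_one hab, norm_mul, norm_mul, Complex.norm_I, one_mul,
      Complex.norm_real, mul_pow, Real.norm_eq_abs, sq_abs]
  refine ⟨h0.trans (pow_le_pow_left₀ t1 (by linarith) 2),
    h2.trans (pow_le_pow_left₀ t1 (by linarith) 2), ?_, fun t' ht' => ?_⟩
  · refine le_trans (b := Real.sqrt (2 * S) * (q * R')) ?_ (by linarith)
    refine le_of_sq_le_sq ((sum_norm_sq_le hS _ s).trans ?_) t3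
    rw [mul_pow, Real.sq_sqrt (by positivity)]
    simp only [add_mul, one_mul, Finset.sum_add_distrib]
    calc _ ≤ S * ((q * R') ^ 2 + (q * R') ^ 2) := by gcongr
      _ = _ := by ring
  · simp only [← fourierCoef_L2_sub hab]
    refine (sum_sq_fourierCoef_L2_le hab _ s).trans ?_
    rw [← hq2, ← mul_pow]
    refine pow_le_pow_left₀ (by positivity) ?_ 2
    have h3 := hQ.dist_le_mul t ht t' ht'
    rw [dist_eq_norm, Real.dist_eq] at h3
    calc q * ‖wderiv (ψ t) 0 - wderiv (ψ t') 0‖ ≤ q * (Q * |t - t'|) := by gcongr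
      _ = q * Q * |t - t'| := by ring
      _ ≤ K * |t - t'| := by gcongr; linarith

/-- The Fourier coefficients of the exact solution solve a system of ordinary differential
equations. -/
theorem IsNLSSolution.hasDerivAt_fourierCoef {a b T β σ M : ℝ} (hab : a < b) (hσ : 0 < σ)
    (hM : 0 ≤ M) {V : ℝ → ℝ} (hV : MemLp V ⊤ (volOn a b)) {ψ₀ : ℝ → ℂ} {ψ : ℝ → Sobolev a b 2}
    (hψ : IsNLSSolution a b T V β σ ψ₀ ψ) {t : ℝ} (ht : t ∈ Ioo 0 T)
    (hb : ∀ᵐ x ∂(volOn a b), ‖wderiv (ψ t) 0 x‖ ≤ M) (l : ℤ) :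
    HasDerivAt (fun t => fourierCoef a b (wderiv (ψ t) 0) l)
      (-Complex.I * ((freq a b l ^ 2 : ℝ) : ℂ) * fourierCoef a b (wderiv (ψ t) 0) l
        - Complex.I * fourierCoef a b (opB V β σ (wderiv (ψ t) 0)) l) t := by
  have htc := Ioo_subset_Icc_self ht
  have hd : HasDerivAt (fun s => wderiv (ψ s) 0)
      (derivWithin (fun s => wderiv (ψ s) 0) (Icc 0 T) t) t :=
    ((hψ.contDiffOn.differentiableOn (by norm_num)) t htc).hasDerivWithinAt.hasDerivAt
      (Icc_mem_nhds ht.1 ht.2)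
  have h := ((fourierCoefL a b hab l).restrictScalars ℝ).hasFDerivAt.comp_hasDerivAt t hd
  refine HasDerivAt.congr_deriv (f := fun t => fourierCoef a b (wderiv (ψ t) 0) l) h ?_
  have hB := memLp_opB (β := β) hσ hM hV (Lp.memLp (wderiv (ψ t) 0)) hb
  set d : L2 a b := derivWithin (fun s => wderiv (ψ s) 0) (Icc 0 T) t with hdef
  change fourierCoef a b d l = _
  have hae : d =ᵐ[volOn a b]
      fun x => Complex.I * wderiv (ψ t) 2 x - Complex.I * opB V β σ (wderiv (ψ t) 0) x := by
    filter_upwards [hψ.equation t (Ioo_subset_Ioc_self ht)] with x hx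
    linear_combination (-Complex.I) * hx
      + d x * Complex.I_sq
  rw [fourierCoef_congr_ae hab hae, fourierCoef_sub hab ((Lp.memLp _).const_mul _)
    (hB.const_mul _), fourierCoef_const_mul, fourierCoef_const_mul,
    (hψ.periodic t htc).fourierCoef_wderiv_two hab]
  ring

theorem IsNLSSolution.continuousOn_fourierCoef {a b T β σ : ℝ} (hab : a < b) {V : ℝ → ℝ}
    {ψ₀ : ℝ → ℂ} {ψ : ℝ → Sobolev a b 2} (hψ : IsNLSSolution a b T V β σ ψ₀ ψ) (l : ℤ) :
    ContinuousOn (fun t => fourierCoef a b (wderiv (ψ t) 0) l) (Icc 0 T) :=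
  (fourierCoefL a b hab l).continuous.comp_continuousOn hψ.contDiffOn.continuousOn

/-! ### Stability and convergence of the abstract symmetric integrator -/

theorem mul_phi1 (z : ℂ) : z * phi1 z = Complex.exp z - 1 := by
  by_cases h : z = 0
  · simp [h]
  · rw [phi1, if_neg h, mul_div_cancel₀ _ h]

theorem norm_exp_I_mul_sub_one_le (w t : ℝ) :
    ‖Complex.exp (Complex.I * w * t) - 1‖ ≤ |t| * |w| := by
  have h := Real.norm_exp_I_mul_ofReal_sub_one_le (x := w * t)
  rw [Complex.ofReal_mul, ← mul_assoc, Real.norm_eq_abs, abs_mul, mul_comm |w|] at h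
  exact h

theorem norm_phi1_le_one (t w : ℝ) : ‖phi1 (-Complex.I * t * w)‖ ≤ 1 := by
  by_cases h : (-Complex.I * t * w : ℂ) = 0
  · rw [phi1, if_pos h, norm_one]
  · have h1 := norm_exp_I_mul_sub_one_le w (-t)
    have h2 := mul_phi1 (-Complex.I * t * w)
    rw [show Complex.I * w * ((-t : ℝ) : ℂ) = -Complex.I * t * w by push_cast; ring, ← h2, norm_mul]
      at h1
    have h3 : ‖(-Complex.I * t * w : ℂ)‖ = |-t| * |w| := by
      rw [norm_mul, norm_mul, norm_neg, Complex.norm_I, Complex.norm_real, Complex.norm_real]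
      simp
    rw [← h3] at h1
    exact le_of_mul_le_mul_left (by simpa using h1) (norm_pos_iff.2 h)

/-- The filter absorbs one factor `w = μ²` without loss; the `H²` stability rests on this
cancellation. -/
theorem two_I_mul_exp_mul_sinc (w t : ℝ) :
    (w : ℂ) * (2 * Complex.I * t * Complex.exp (Complex.I * w * ((-t : ℝ) : ℂ))
      * (Real.sinc (t * w) : ℂ)) = 1 - Complex.exp (Complex.I * w * ((-(2 * t) : ℝ) : ℂ)) := by
  have h : ((t * w : ℝ) : ℂ) * (Real.sinc (t * w) : ℂ) = Complex.sin (t * w) := by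
    by_cases h : t * w = 0
    · rw [show (t * w : ℂ) = ((t * w : ℝ) : ℂ) by push_cast; ring, h]; simp
    · rw [Real.sinc_of_ne_zero h, Complex.ofReal_div,
        mul_div_cancel₀ _ (Complex.ofReal_ne_zero.2 h)]
      push_cast; rfl
  have h2 : (w : ℂ) * (2 * Complex.I * t * Complex.exp (Complex.I * w * ((-t : ℝ) : ℂ))
      * (Real.sinc (t * w) : ℂ)) = 2 * Complex.I * Complex.exp (Complex.I * w * ((-t : ℝ) : ℂ))
        * (((t * w : ℝ) : ℂ) * (Real.sinc (t * w) : ℂ)) := by push_cast; ring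
  rw [h2, h, Complex.sin]
  have e1 : Complex.exp (Complex.I * w * ((-t : ℝ) : ℂ)) * Complex.exp (-((t : ℂ) * w) * Complex.I)
      = Complex.exp (Complex.I * w * ((-(2 * t) : ℝ) : ℂ)) := by
    rw [← Complex.exp_add]; congr 1; push_cast; ring
  have e2 : Complex.exp (Complex.I * w * ((-t : ℝ) : ℂ)) * Complex.exp ((t : ℂ) * w * Complex.I)
      = 1 := by
    rw [← Complex.exp_add, ← Complex.exp_zero]; congr 1; push_cast; ring
  linear_combination (Complex.I ^ 2) * e1 - (Complex.I ^ 2) * e2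
    + (Complex.exp (Complex.I * w * ((-(2 * t) : ℝ) : ℂ)) - 1) * Complex.I_sq

/-- The symmetric exponential wave integrator for the coefficients `u n l`, `l ∈ s`, with
frequencies `w l`, time step `τ` and forcing `G`. -/
structure IsSymmetricEWI (s : Finset ℤ) (w : ℤ → ℝ) (τ : ℝ) (u G : ℕ → ℤ → ℂ) : Prop where
  one : ∀ l ∈ s, u 1 l = Complex.exp (Complex.I * w l * ((-τ : ℝ) : ℂ)) * u 0 l
    - Complex.I * (τ * phi1 (-Complex.I * τ * w l)) * G 0 l
  add_two : ∀ n, ∀ l ∈ s, u (n + 2) l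
    = Complex.exp (Complex.I * w l * ((-(2 * τ) : ℝ) : ℂ)) * u n l
      - 2 * Complex.I * τ * Complex.exp (Complex.I * w l * ((-τ : ℝ) : ℂ))
        * (Real.sinc (τ * w l) : ℂ) * G (n + 1) l

/-- From `|e^{iθ} - 1| ≤ |θ|`: a time increment costs a factor `τ` and two space derivatives. With
truncated subtraction, `n = 0` is the first step `u 1 - u 0`. -/
theorem IsSymmetricEWI.coefNorm_sub_le {s : Finset ℤ} {w : ℤ → ℝ} {τ : ℝ} {u G : ℕ → ℤ → ℂ}
    (h : IsSymmetricEWI s w τ u G) (hτ : 0 < τ) (n : ℕ) :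
    coefNorm s (fun l => u (n + 1) l - u (n - 1) l)
      ≤ 2 * τ * (coefNorm s (fun l => w l * u (n - 1) l) + coefNorm s (G n)) := by
  match n with
  | 0 =>
    have h1 : coefNorm s (fun l => u 1 l - u 0 l) = coefNorm s (fun l =>
        (Complex.exp (Complex.I * w l * ((-τ : ℝ) : ℂ)) - 1) * u 0 l
          - Complex.I * (τ * phi1 (-Complex.I * τ * w l)) * G 0 l) :=
      coefNorm_eq fun l hl => by rw [h.one l hl]; ring_nf
    have h2 : coefNorm s (fun l => (Complex.exp (Complex.I * w l * ((-τ : ℝ) : ℂ)) - 1) * u 0 l)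
        ≤ (2 * τ) * coefNorm s (fun l => w l * u 0 l) := by
      refine coefNorm_le_mul (by positivity) fun l _ => ?_
      rw [norm_mul, norm_mul, Complex.norm_real, Real.norm_eq_abs, ← mul_assoc]
      have h3 := norm_exp_I_mul_sub_one_le (w l) (-τ)
      rw [abs_neg, abs_of_pos hτ] at h3
      have h4 : τ * |w l| ≤ 2 * τ * |w l| := by nlinarith [abs_nonneg (w l)]
      exact mul_le_mul_of_nonneg_right (h3.trans h4) (norm_nonneg _)
    have h3 : coefNorm s (fun l => Complex.I * (τ * phi1 (-Complex.I * τ * w l)) * G 0 l)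
        ≤ (2 * τ) * coefNorm s (G 0) := by
      refine coefNorm_le_mul (by positivity) fun l _ => ?_
      rw [norm_mul, norm_mul, norm_mul, Complex.norm_I, one_mul, Complex.norm_real,
        Real.norm_of_nonneg hτ.le]
      have := norm_phi1_le_one τ (w l)
      have h4 : τ * ‖phi1 (-Complex.I * τ * w l)‖ ≤ 2 * τ := by nlinarith
      exact mul_le_mul_of_nonneg_right h4 (norm_nonneg _)
    have := _root_.coefNorm_sub_le s
      (fun l => (Complex.exp (Complex.I * w l * ((-τ : ℝ) : ℂ)) - 1) * u 0 l)
      (fun l => Complex.I * (τ * phi1 (-Complex.I * τ * w l)) * G 0 l)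
    change coefNorm s (fun l => u 1 l - u 0 l) ≤ _ * (coefNorm s (fun l => w l * u 0 l) + _)
    rw [h1]
    linarith
  | n + 1 =>
    have h1 : coefNorm s (fun l => u (n + 2) l - u n l) = coefNorm s (fun l =>
        (Complex.exp (Complex.I * w l * ((-(2 * τ) : ℝ) : ℂ)) - 1) * u n l
          - 2 * Complex.I * τ * Complex.exp (Complex.I * w l * ((-τ : ℝ) : ℂ))
        * (Real.sinc (τ * w l) : ℂ) * G (n + 1) l) :=
      coefNorm_eq fun l hl => by rw [h.add_two n l hl]; ring_nf
    have h2 : coefNorm s (fun l =>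
        (Complex.exp (Complex.I * w l * ((-(2 * τ) : ℝ) : ℂ)) - 1) * u n l)
        ≤ (2 * τ) * coefNorm s (fun l => w l * u n l) := by
      refine coefNorm_le_mul (by positivity) fun l _ => ?_
      rw [norm_mul, norm_mul, Complex.norm_real, Real.norm_eq_abs, ← mul_assoc]
      have h3 := norm_exp_I_mul_sub_one_le (w l) (-(2 * τ))
      rw [abs_neg, abs_of_pos (by positivity)] at h3
      exact mul_le_mul_of_nonneg_right h3 (norm_nonneg _)
    have h3 : coefNorm s (fun l => 2 * Complex.I * τ *
        Complex.exp (Complex.I * w l * ((-τ : ℝ) : ℂ)) * (Real.sinc (τ * w l) : ℂ) * G (n + 1) l)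
        ≤ (2 * τ) * coefNorm s (G (n + 1)) := by
      refine coefNorm_le_mul (by positivity) fun l _ => ?_
      rw [norm_mul, norm_mul, norm_mul, norm_mul, norm_mul, Complex.norm_I, norm_exp_I_mul,
        Complex.norm_real, Real.norm_of_nonneg hτ.le, Complex.norm_real, Complex.norm_ofNat,
        mul_one, mul_one]
      have h4 : ‖Real.sinc (τ * w l)‖ ≤ 1 := Real.abs_sinc_le_one _
      exact mul_le_mul_of_nonneg_right (mul_le_of_le_one_right (by positivity) h4) (norm_nonneg _)
    have := _root_.coefNorm_sub_le s
      (fun l => (Complex.exp (Complex.I * w l * ((-(2 * τ) : ℝ) : ℂ)) - 1) * u n l)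
      (fun l => 2 * Complex.I * τ * Complex.exp (Complex.I * w l * ((-τ : ℝ) : ℂ))
        * (Real.sinc (τ * w l) : ℂ) * G (n + 1) l)
    change coefNorm s (fun l => u (n + 2) l - u n l) ≤ _ * (coefNorm s (fun l => w l * u n l) + _)
    rw [h1]
    linarith

/-- Stability in `H²`. -/
theorem IsSymmetricEWI.coefNorm_mul_le {s : Finset ℤ} {w : ℤ → ℝ} {τ : ℝ} {u G : ℕ → ℤ → ℂ}
    (h : IsSymmetricEWI s w τ u G) (hτ : 0 < τ) {L G₀ b₀ : ℝ} {n₀ : ℕ} (hL : 0 ≤ L) (hG₀ : 0 ≤ G₀)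
    (hG : ∀ n ≤ n₀, coefNorm s (G n) ≤ G₀) (hb₀ : coefNorm s (fun l => w l * u 0 l) ≤ b₀)
    (hlip : ∀ n ≤ n₀, ∀ m ≤ n₀, coefNorm s (fun l => G n l - G m l)
      ≤ L * coefNorm s (fun l => u n l - u m l)) :
    ∀ n ≤ n₀ + 1, coefNorm s (fun l => w l * u n l)
      ≤ (1 + 2 * L * τ) ^ n * (b₀ + G₀ + 4 * L * G₀ * τ * n) + G₀ := by
  -- The modified `H²` quantity. Since `0 - 1 = 0` in `ℕ`, both `e 0` and `e 1` involve `G 0`, and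
  -- the first step preserves `e` exactly.
  set e : ℕ → ℝ := fun n => coefNorm s (fun l => w l * u n l + G (n - 1) l) with he
  have hb₀0 : 0 ≤ b₀ := (coefNorm_nonneg _ _).trans hb₀
  have hwu : ∀ n ≤ n₀ + 1, coefNorm s (fun l => w l * u n l) ≤ e n + G₀ := by
    intro n hn
    have h1 := _root_.coefNorm_sub_le s (fun l => w l * u n l + G (n - 1) l) (G (n - 1))
    simp only [add_sub_cancel_right] at h1
    have h2 := hG (n - 1) (by omega)
    linarith
  have he0 : e 0 ≤ b₀ + G₀ := by
    have h1 := coefNorm_add_le s (fun l => w l * u 0 l) (G 0)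
    have h2 := hG 0 (by omega)
    change coefNorm s (fun l => w l * u 0 l + G 0 l) ≤ _
    linarith
  have he1 : e 1 = e 0 := by
    refine coefNorm_eq fun l hl => ?_
    have h1 := mul_phi1 (-Complex.I * τ * w l)
    have h2 : -Complex.I * τ * w l = Complex.I * w l * ((-τ : ℝ) : ℂ) := by push_cast; ring
    have h3 : w l * u 1 l + G (1 - 1) l
        = Complex.exp (Complex.I * w l * ((-τ : ℝ) : ℂ)) * (w l * u 0 l + G (0 - 1) l) := by
      rw [h.one l hl]
      rw [h2] at h1 ⊢
      simp only [Nat.sub_self, Nat.zero_sub]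
      linear_combination (G 0 l) * h1 + (G 0 l) * phi1 (Complex.I * w l * ((-τ : ℝ) : ℂ)) * h2
    rw [h3, norm_mul, norm_exp_I_mul, one_mul]
  have hstep : ∀ n, e (n + 2) = coefNorm s (fun l => (w l * u n l + G (n - 1) l)
      + (G (n + 1) l - G (n - 1) l)) := by
    intro n
    refine coefNorm_eq fun l hl => ?_
    have h1 := two_I_mul_exp_mul_sinc (w l) τ
    have h3 : w l * u (n + 2) l + G (n + 2 - 1) l
        = Complex.exp (Complex.I * w l * ((-(2 * τ) : ℝ) : ℂ)) * ((w l * u n l + G (n - 1) l)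
      + (G (n + 1) l - G (n - 1) l)) := by
      rw [h.add_two n l hl, show n + 2 - 1 = n + 1 from rfl]
      linear_combination (-G (n + 1) l) * h1
    rw [h3, norm_mul, norm_exp_I_mul, one_mul]
  -- The increment of `G` is at most `L * 2τ * (e (n - 1) + 2 * G₀)`, whence `A` and `B`.
  have hgr := two_step_gronwall (e := e) (A := 2 * L * τ) (B := 4 * L * G₀ * τ) (m := b₀ + G₀)
    (n₀ := n₀ + 1) (by positivity) (by positivity) (by positivity) he0 (fun _ => he1.trans_le he0)
    (fun n hn => ⟨n - 1, by omega, by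
      have h1 := coefNorm_add_le s (fun l => w l * u n l + G (n - 1) l)
        (fun l => G (n + 1) l - G (n - 1) l)
      rw [← hstep] at h1
      have h2 := hlip (n + 1) (by omega) (n - 1) (by omega)
      have h3 := mul_le_mul_of_nonneg_left (h.coefNorm_sub_le hτ n) hL
      have h4 := hwu (n - 1) (by omega)
      have h5 := hG n (by omega)
      have h6 : L * (2 * τ * (coefNorm s (fun l => w l * u (n - 1) l) + coefNorm s (G n)))
          ≤ L * (2 * τ * (e (n - 1) + G₀ + G₀)) := by gcongr
      calc e (n + 2) ≤ e n + L * (2 * τ * (e (n - 1) + G₀ + G₀)) := by linarith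
        _ = _ := by ring⟩)
  intro n hn
  have h1 := hwu n hn
  have h2 := hgr n hn
  linarith

/-- Convergence in `L²`. -/
theorem IsSymmetricEWI.coefNorm_error_le {s : Finset ℤ} {w : ℤ → ℝ} {τ : ℝ} {u G : ℕ → ℤ → ℂ}
    (h : IsSymmetricEWI s w τ u G) (hτ : 0 < τ) {y g : ℕ → ℤ → ℂ} {L δ ρ : ℝ} {n₀ : ℕ}
    (hL : 0 ≤ L) (hδ : 0 ≤ δ) (hρ : 0 ≤ ρ) (h0 : ∀ l ∈ s, y 0 l = u 0 l)
    (h1 : 1 ≤ n₀ → coefNorm s (fun l => y 1 l - (Complex.exp (Complex.I * w l * ((-τ : ℝ) : ℂ)) * y 0 l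
      - Complex.I * (τ * phi1 (-Complex.I * τ * w l)) * g 0 l)) ≤ 2 * τ * ρ)
    (h2 : ∀ n, n + 2 ≤ n₀ → coefNorm s (fun l => y (n + 2) l
      - (Complex.exp (Complex.I * w l * ((-(2 * τ) : ℝ) : ℂ)) * y n l
      - 2 * Complex.I * τ * Complex.exp (Complex.I * w l * ((-τ : ℝ) : ℂ))
        * (Real.sinc (τ * w l) : ℂ) * g (n + 1) l)) ≤ 2 * τ * ρ)
    (hg : ∀ n < n₀, coefNorm s (fun l => g n l - G n l)
      ≤ L * (coefNorm s (fun l => y n l - u n l) + δ)) :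
    ∀ n ≤ n₀, coefNorm s (fun l => y n l - u n l)
      ≤ (1 + 2 * L * τ) ^ n * (2 * τ * (L * δ + ρ) + 2 * τ * (L * δ + ρ) * n) := by
  have he0 : coefNorm s (fun l => y 0 l - u 0 l) = 0 := by
    have h3 := coefNorm_le_mul (s := s) (c := fun l => y 0 l - u 0 l) (d := fun _ => 0) le_rfl
      (fun l hl => by rw [h0 l hl]; simp)
    exact le_antisymm (by simpa using h3) (coefNorm_nonneg _ _)
  -- Per step the forcing error adds `2τ L (e (n + 1) + δ)` and the local error `2τ ρ`; taking `m`
  -- equal to `B` also covers the first step.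
  refine two_step_gronwall (e := fun n => coefNorm s (fun l => y n l - u n l)) (by positivity)
    (by positivity) (by positivity) ?_ ?_ ?_
  · simp only [he0]; positivity
  · intro hn
    have e1 : coefNorm s (fun l => y 1 l - u 1 l) = coefNorm s (fun l =>
        (y 1 l - (Complex.exp (Complex.I * w l * ((-τ : ℝ) : ℂ)) * y 0 l
          - Complex.I * (τ * phi1 (-Complex.I * τ * w l)) * g 0 l))
        - Complex.I * (τ * phi1 (-Complex.I * τ * w l)) * (g 0 l - G 0 l)) :=
      coefNorm_eq fun l hl => by rw [h.one l hl, h0 l hl]; ring_nf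
    have e2 : coefNorm s (fun l => Complex.I * (τ * phi1 (-Complex.I * τ * w l))
        * (g 0 l - G 0 l)) ≤ τ * coefNorm s (fun l => g 0 l - G 0 l) := by
      refine coefNorm_le_mul hτ.le fun l _ => ?_
      rw [norm_mul, norm_mul, norm_mul, Complex.norm_I, one_mul, Complex.norm_real,
        Real.norm_of_nonneg hτ.le]
      exact mul_le_mul_of_nonneg_right
        (mul_le_of_le_one_right hτ.le (norm_phi1_le_one τ (w l))) (norm_nonneg _)
    have e3 := _root_.coefNorm_sub_le s
      (fun l => y 1 l - (Complex.exp (Complex.I * w l * ((-τ : ℝ) : ℂ)) * y 0 l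
          - Complex.I * (τ * phi1 (-Complex.I * τ * w l)) * g 0 l))
      (fun l => Complex.I * (τ * phi1 (-Complex.I * τ * w l)) * (g 0 l - G 0 l))
    rw [← e1] at e3
    have e4 := hg 0 (by omega)
    rw [he0, zero_add] at e4
    have e5 := mul_le_mul_of_nonneg_left e4 hτ.le
    have e6 := h1 hn
    have e7 : 0 ≤ τ * (L * δ) := by positivity
    change coefNorm s (fun l => y 1 l - u 1 l) ≤ _
    linarith
  · intro n hn
    refine ⟨n + 1, le_rfl, ?_⟩
    have e1 : coefNorm s (fun l => y (n + 2) l - u (n + 2) l) = coefNorm s (fun l =>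
        (y (n + 2) l - (Complex.exp (Complex.I * w l * ((-(2 * τ) : ℝ) : ℂ)) * y n l
          - 2 * Complex.I * τ * Complex.exp (Complex.I * w l * ((-τ : ℝ) : ℂ))
            * (Real.sinc (τ * w l) : ℂ) * g (n + 1) l))
        + (Complex.exp (Complex.I * w l * ((-(2 * τ) : ℝ) : ℂ)) * (y n l - u n l)
          - 2 * Complex.I * τ * Complex.exp (Complex.I * w l * ((-τ : ℝ) : ℂ))
            * (Real.sinc (τ * w l) : ℂ) * (g (n + 1) l - G (n + 1) l))) :=
      coefNorm_eq fun l hl => by rw [h.add_two n l hl]; ring_nf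
    have e2 : coefNorm s (fun l => 2 * Complex.I * τ *
        Complex.exp (Complex.I * w l * ((-τ : ℝ) : ℂ))
            * (Real.sinc (τ * w l) : ℂ) * (g (n + 1) l - G (n + 1) l))
        ≤ (2 * τ) * coefNorm s (fun l => g (n + 1) l - G (n + 1) l) := by
      refine coefNorm_le_mul (by positivity) fun l _ => ?_
      rw [norm_mul, norm_mul, norm_mul, norm_mul, norm_mul, Complex.norm_I, norm_exp_I_mul,
        Complex.norm_real, Real.norm_of_nonneg hτ.le, Complex.norm_real, Complex.norm_ofNat,
        mul_one, mul_one]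
      have h4 : ‖Real.sinc (τ * w l)‖ ≤ 1 := Real.abs_sinc_le_one _
      exact mul_le_mul_of_nonneg_right (mul_le_of_le_one_right (by positivity) h4) (norm_nonneg _)
    have e3 : coefNorm s (fun l =>
        Complex.exp (Complex.I * w l * ((-(2 * τ) : ℝ) : ℂ)) * (y n l - u n l))
        = coefNorm s (fun l => y n l - u n l) :=
      coefNorm_eq fun l _ => by rw [norm_mul, norm_exp_I_mul, one_mul]
    have e4 := coefNorm_add_le s
      (fun l => y (n + 2) l - (Complex.exp (Complex.I * w l * ((-(2 * τ) : ℝ) : ℂ)) * y n l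
          - 2 * Complex.I * τ * Complex.exp (Complex.I * w l * ((-τ : ℝ) : ℂ))
            * (Real.sinc (τ * w l) : ℂ) * g (n + 1) l))
      (fun l => Complex.exp (Complex.I * w l * ((-(2 * τ) : ℝ) : ℂ)) * (y n l - u n l)
          - 2 * Complex.I * τ * Complex.exp (Complex.I * w l * ((-τ : ℝ) : ℂ))
            * (Real.sinc (τ * w l) : ℂ) * (g (n + 1) l - G (n + 1) l))
    have e5 := _root_.coefNorm_sub_le s
      (fun l => Complex.exp (Complex.I * w l * ((-(2 * τ) : ℝ) : ℂ)) * (y n l - u n l))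
      (fun l => 2 * Complex.I * τ * Complex.exp (Complex.I * w l * ((-τ : ℝ) : ℂ))
            * (Real.sinc (τ * w l) : ℂ) * (g (n + 1) l - G (n + 1) l))
    have e6 := mul_le_mul_of_nonneg_left (hg (n + 1) (by omega)) (by positivity : 0 ≤ 2 * τ)
    have e7 := h2 n hn
    rw [← e1] at e4
    change coefNorm s (fun l => y (n + 2) l - u (n + 2) l) ≤ coefNorm s (fun l => y n l - u n l)
      + 2 * L * τ * coefNorm s (fun l => y (n + 1) l - u (n + 1) l) + _
    linarith

/-! ### The numerical solution on the Fourier side -/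

theorem exists_sEWIFS_eq_trigPoly (a b : ℝ) (V : ℝ → ℝ) (β σ : ℝ) (ψ₀ : ℝ → ℂ) (τ : ℝ) (N n : ℕ) :
    ∃ c, sEWIFS a b V β σ ψ₀ τ N n = trigPoly a b N c := by
  match n with
  | 0 => exact ⟨_, by rw [sEWIFS]⟩
  | 1 => exact ⟨_, by rw [sEWIFS]⟩
  | n + 2 => exact ⟨_, by rw [sEWIFS]⟩

theorem sEWIFS_eq_trigPoly {a b : ℝ} (hab : a < b) (V : ℝ → ℝ) (β σ : ℝ) (ψ₀ : ℝ → ℂ) (τ : ℝ)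
    (N n : ℕ) : sEWIFS a b V β σ ψ₀ τ N n
      = trigPoly a b N (fourierCoef a b (sEWIFS a b V β σ ψ₀ τ N n)) := by
  obtain ⟨c, hc⟩ := exists_sEWIFS_eq_trigPoly a b V β σ ψ₀ τ N n
  rw [hc, trigPoly_fourierCoef_trigPoly hab]

theorem fourierCoef_sEWIFS_of_notMem {a b : ℝ} (hab : a < b) (V : ℝ → ℝ) (β σ : ℝ) (ψ₀ : ℝ → ℂ)
    (τ : ℝ) {N : ℕ} (n : ℕ) {l : ℤ} (hl : l ∉ indexSet N) :
    fourierCoef a b (sEWIFS a b V β σ ψ₀ τ N n) l = 0 := by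
  obtain ⟨c, hc⟩ := exists_sEWIFS_eq_trigPoly a b V β σ ψ₀ τ N n
  rw [hc, fourierCoef_trigPoly hab, if_neg hl]

theorem memLp_sEWIFS {a b : ℝ} (V : ℝ → ℝ) (β σ : ℝ) (ψ₀ : ℝ → ℂ) (τ : ℝ) (N n : ℕ) :
    MemLp (sEWIFS a b V β σ ψ₀ τ N n) 2 (volOn a b) := by
  obtain ⟨c, hc⟩ := exists_sEWIFS_eq_trigPoly a b V β σ ψ₀ τ N n
  rw [hc]
  exact memLp_trigPoly a b N c

theorem fourierCoef_sEWIFS_zero {a b : ℝ} (hab : a < b) (V : ℝ → ℝ) (β σ : ℝ) (ψ₀ : ℝ → ℂ) (τ : ℝ)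
    {N : ℕ} {l : ℤ} (hl : l ∈ indexSet N) :
    fourierCoef a b (sEWIFS a b V β σ ψ₀ τ N 0) l = fourierCoef a b ψ₀ l := by
  rw [sEWIFS, fourierCoef_trigPoly hab, if_pos hl]

theorem isSymmetricEWI_sEWIFS {a b : ℝ} (hab : a < b) (V : ℝ → ℝ) (β σ : ℝ) (ψ₀ : ℝ → ℂ) (τ : ℝ)
    (N : ℕ) : IsSymmetricEWI (indexSet N) (fun l => freq a b l ^ 2) τ
      (fun n => fourierCoef a b (sEWIFS a b V β σ ψ₀ τ N n))
      (fun n => fourierCoef a b (opB V β σ (sEWIFS a b V β σ ψ₀ τ N n))) where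
  one l hl := by
    have h0 : sEWIFS a b V β σ ψ₀ τ N 0 = trigPoly a b N (fourierCoef a b ψ₀) := by rw [sEWIFS]
    simp only [h0]
    rw [sEWIFS, fourierCoef_trigPoly hab, if_pos hl]
    push_cast
    ring_nf
  add_two n l hl := by
    rw [sEWIFS, fourierCoef_trigPoly hab, if_pos hl]
    push_cast
    ring_nf

theorem sum_sq_le_coefNorm_sq_add (s r : Finset ℤ) (c : ℤ → ℂ) :
    ∑ l ∈ r, ‖c l‖ ^ 2 ≤ coefNorm s c ^ 2 + ∑ l ∈ r \ s, ‖c l‖ ^ 2 := by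
  rw [coefNorm_sq, add_comm]
  refine (Finset.sum_le_sum_of_subset_of_nonneg (t := (r \ s) ∪ s) ?_
    fun _ _ _ => by positivity).trans ?_
  · intro l hl
    by_cases h : l ∈ s <;> simp [h, hl]
  · rw [Finset.sum_union Finset.sdiff_disjoint]

theorem sum_sq_le_coefNorm_sq {s : Finset ℤ} (r : Finset ℤ) {c : ℤ → ℂ} (hc : ∀ l ∉ s, c l = 0) :
    ∑ l ∈ r, ‖c l‖ ^ 2 ≤ coefNorm s c ^ 2 := by
  have h := sum_sq_le_coefNorm_sq_add s r c
  have h0 : ∑ l ∈ r \ s, ‖c l‖ ^ 2 = 0 :=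
    Finset.sum_eq_zero fun l hl => by simp [hc l (Finset.mem_sdiff.1 hl).2]
  rwa [h0, add_zero] at h

/-- The projection error is of second order in the mesh size. -/
theorem sum_sq_sub_le {a b h K : ℝ} (hab : a < b) {N : ℕ} (hN : 0 < N) (hE : Even N)
    (hh : h = (b - a) / N) {c d : ℤ → ℂ} (hd : ∀ l ∉ indexSet N, d l = 0)
    (hc : ∀ s : Finset ℤ, ∑ l ∈ s, (freq a b l ^ 2 * ‖c l‖) ^ 2 ≤ K ^ 2) (r : Finset ℤ) :
    ∑ l ∈ r, ‖c l - d l‖ ^ 2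
      ≤ coefNorm (indexSet N) (fun l => c l - d l) ^ 2 + (h ^ 2 * K) ^ 2 := by
  refine (sum_sq_le_coefNorm_sq_add (indexSet N) r _).trans (add_le_add_right ?_ _)
  have h1 : ∀ l ∈ r \ indexSet N,
      ‖c l - d l‖ ^ 2 ≤ (h ^ 2) ^ 2 * (freq a b l ^ 2 * ‖c l‖) ^ 2 := by
    intro l hl
    have hl' := (Finset.mem_sdiff.1 hl).2
    rw [hd l hl', sub_zero, ← mul_pow, ← mul_assoc]
    have h2 := one_le_sq_mul_freq_sq hab hN hE hh hl'
    exact pow_le_pow_left₀ (norm_nonneg _) (le_mul_of_one_le_left (norm_nonneg _) h2) 2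
  refine (Finset.sum_le_sum h1).trans ?_
  rw [← Finset.mul_sum, mul_pow]
  exact mul_le_mul_of_nonneg_left (hc _) (by positivity)

/-! ### Consistency and the bootstrap -/

theorem IsNLSSolution.coefNorm_opB_sub_le {a b T β σ K M : ℝ} (hab : a < b) (hσ : 0 < σ)
    (hM : 0 ≤ M) (hK : 0 ≤ K) {V : ℝ → ℝ} (hV : MemLp V ⊤ (volOn a b)) {ψ : ℝ → Sobolev a b 2}
    (hb : ∀ t ∈ Icc 0 T, ∀ᵐ x ∂(volOn a b), ‖wderiv (ψ t) 0 x‖ ≤ M)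
    (hlip : ∀ t ∈ Icc 0 T, ∀ t' ∈ Icc 0 T, ∀ s : Finset ℤ,
      ∑ l ∈ s, ‖fourierCoef a b (wderiv (ψ t) 0) l - fourierCoef a b (wderiv (ψ t') 0) l‖ ^ 2
        ≤ (K * |t - t'|) ^ 2) (s : Finset ℤ) {t t' : ℝ} (ht : t ∈ Icc 0 T) (ht' : t' ∈ Icc 0 T) :
    coefNorm s (fun l => fourierCoef a b (opB V β σ (wderiv (ψ t) 0)) l
      - fourierCoef a b (opB V β σ (wderiv (ψ t') 0)) l)
      ≤ lipB a b V β σ M * (K * |t - t'|) :=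
  coefNorm_fourierCoef_opB_sub_le hab hσ hM (by positivity) hV (Lp.memLp _) (Lp.memLp _)
    (hb t ht) (hb t' ht') s (hlip t ht t' ht')

/-- Consistency of the scheme. -/
theorem IsNLSSolution.consistency {a b T β σ K M τ : ℝ} (hab : a < b) (hσ : 0 < σ)
    (hM : 0 ≤ M) (hK : 0 ≤ K) {V : ℝ → ℝ} (hV : MemLp V ⊤ (volOn a b)) {ψ₀ : ℝ → ℂ}
    {ψ : ℝ → Sobolev a b 2} (hψ : IsNLSSolution a b T V β σ ψ₀ ψ)
    (hb : ∀ t ∈ Icc 0 T, ∀ᵐ x ∂(volOn a b), ‖wderiv (ψ t) 0 x‖ ≤ M)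
    (hlip : ∀ t ∈ Icc 0 T, ∀ t' ∈ Icc 0 T, ∀ s : Finset ℤ,
      ∑ l ∈ s, ‖fourierCoef a b (wderiv (ψ t) 0) l - fourierCoef a b (wderiv (ψ t') 0) l‖ ^ 2
        ≤ (K * |t - t'|) ^ 2) (s : Finset ℤ) {p q r : ℝ} (hp : 0 ≤ p) (hpr : p ≤ r) (hrq : r < q)
    (hq : q ≤ T) (hpτ : r - p ≤ τ) (hqτ : q - r ≤ τ) :
    coefNorm s (fun l => fourierCoef a b (wderiv (ψ q) 0) l
      - (Complex.exp (Complex.I * ((freq a b l ^ 2 : ℝ) : ℂ) * ((p - q : ℝ) : ℂ))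
          * fourierCoef a b (wderiv (ψ p) 0) l
      - Complex.I * Complex.exp (Complex.I * ((freq a b l ^ 2 : ℝ) : ℂ) * ((r - q : ℝ) : ℂ))
        * (((q - r : ℝ) : ℂ) * phi1 (Complex.I * ((freq a b l ^ 2 : ℝ) : ℂ) * ((q - r : ℝ) : ℂ))
          - ((p - r : ℝ) : ℂ) * phi1 (Complex.I * ((freq a b l ^ 2 : ℝ) : ℂ) * ((p - r : ℝ) : ℂ)))
        * fourierCoef a b (opB V β σ (wderiv (ψ r) 0)) l))
      ≤ 2 * τ * (lipB a b V β σ M * K * τ) := by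
  have hL := lipB_nonneg (a := a) (b := b) (V := V) (β := β) hσ hM
  have hτ : 0 < τ := (sub_pos.2 hrq).trans_le hqτ
  have hsub : Icc p q ⊆ Icc 0 T := Icc_subset_Icc hp hq
  -- On `[p, q]` the forcing moves by at most `lipB * K * τ` from its value at `r`, and `q - p ≤
  -- 2τ`. The case `p = r` serves the first step, the midpoint the others.
  have h := coefNorm_duhamel_le (s := s) (w := fun l => freq a b l ^ 2)
    (y := fun t l => fourierCoef a b (wderiv (ψ t) 0) l)
    (g := fun t l => fourierCoef a b (opB V β σ (wderiv (ψ t) 0)) l) (p := p) (q := q)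
    (K := lipB a b V β σ M * K * τ) r (by linarith) (by positivity)
    (fun l => (hψ.continuousOn_fourierCoef hab l).mono hsub)
    (fun l t ht => hψ.hasDerivAt_fourierCoef hab hσ hM hV ⟨hp.trans_lt ht.1, ht.2.trans_le hq⟩
      (hb t (hsub (Ioo_subset_Icc_self ht))) l)
    (fun t ht => by
      refine (IsNLSSolution.coefNorm_opB_sub_le hab hσ hM hK hV hb hlip s
        (hsub (Ioo_subset_Icc_self ht)) (hsub ⟨hpr, hrq.le⟩)).trans ?_
      have : |t - r| ≤ τ := by
        rw [abs_le]; constructor <;> linarith [ht.1, ht.2]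
      calc _ ≤ lipB a b V β σ M * (K * τ) := by gcongr
        _ = _ := by ring)
  refine h.trans ?_
  rw [mul_comm]
  gcongr
  linarith

theorem coefNorm_le_of_sum_norm_le {s : Finset ℤ} {c : ℤ → ℂ} {M : ℝ} (h : ∑ l ∈ s, ‖c l‖ ≤ M) :
    coefNorm s c ≤ M := by
  have h0 : 0 ≤ ∑ l ∈ s, ‖c l‖ := Finset.sum_nonneg fun _ _ => norm_nonneg _
  refine le_of_sq_le_sq ?_ (h0.trans h)
  rw [coefNorm_sq]
  exact (Finset.sum_sq_le_sq_sum_of_nonneg fun _ _ => norm_nonneg _).trans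
    (pow_le_pow_left₀ h0 h 2)

theorem ae_norm_sEWIFS_le {a b : ℝ} (hab : a < b) {V : ℝ → ℝ} {β σ : ℝ} {ψ₀ : ℝ → ℂ} {τ M : ℝ}
    {N n : ℕ} (h : ∑ l ∈ indexSet N, ‖fourierCoef a b (sEWIFS a b V β σ ψ₀ τ N n) l‖ ≤ M) :
    ∀ᵐ x ∂(volOn a b), ‖sEWIFS a b V β σ ψ₀ τ N n x‖ ≤ M := by
  refine Eventually.of_forall fun x => ?_
  rw [sEWIFS_eq_trigPoly hab]
  exact (norm_trigPoly_le _ _ _ _ _).trans h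

theorem coefNorm_opB_sEWIFS_sub_le {a b : ℝ} (hab : a < b) {V : ℝ → ℝ} {β σ : ℝ} (hσ : 0 < σ)
    (hV : MemLp V ⊤ (volOn a b)) {ψ₀ : ℝ → ℂ} {τ M : ℝ} (hM : 0 ≤ M) {N n m : ℕ}
    (hn : ∑ l ∈ indexSet N, ‖fourierCoef a b (sEWIFS a b V β σ ψ₀ τ N n) l‖ ≤ M)
    (hm : ∑ l ∈ indexSet N, ‖fourierCoef a b (sEWIFS a b V β σ ψ₀ τ N m) l‖ ≤ M) :
    coefNorm (indexSet N) (fun l => fourierCoef a b (opB V β σ (sEWIFS a b V β σ ψ₀ τ N n)) l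
      - fourierCoef a b (opB V β σ (sEWIFS a b V β σ ψ₀ τ N m)) l)
      ≤ lipB a b V β σ M * coefNorm (indexSet N) (fun l =>
        fourierCoef a b (sEWIFS a b V β σ ψ₀ τ N n) l
          - fourierCoef a b (sEWIFS a b V β σ ψ₀ τ N m) l) :=
  coefNorm_fourierCoef_opB_sub_le hab hσ hM (coefNorm_nonneg _ _) hV (memLp_sEWIFS _ _ _ _ _ _ _)
    (memLp_sEWIFS _ _ _ _ _ _ _) (ae_norm_sEWIFS_le hab hn) (ae_norm_sEWIFS_le hab hm) _
    (fun r => sum_sq_le_coefNorm_sq r fun l hl => by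
      rw [fourierCoef_sEWIFS_of_notMem hab V β σ ψ₀ τ n hl,
        fourierCoef_sEWIFS_of_notMem hab V β σ ψ₀ τ m hl, sub_zero])

theorem coefNorm_opB_sEWIFS_le {a b : ℝ} (hab : a < b) {V : ℝ → ℝ} {β σ : ℝ} (hσ : 0 < σ)
    (hV : MemLp V ⊤ (volOn a b)) {ψ₀ : ℝ → ℂ} {τ M : ℝ} (hM : 0 ≤ M) {N n : ℕ}
    (hn : ∑ l ∈ indexSet N, ‖fourierCoef a b (sEWIFS a b V β σ ψ₀ τ N n) l‖ ≤ M) :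
    coefNorm (indexSet N) (fourierCoef a b (opB V β σ (sEWIFS a b V β σ ψ₀ τ N n)))
      ≤ lipB a b V β σ M * M := by
  have h0 : ∀ l, fourierCoef a b (fun _ => 0) l = 0 := fun l => by simp [fourierCoef]
  have h := coefNorm_fourierCoef_opB_sub_le (β := β) hab hσ hM hM hV
    (memLp_sEWIFS V β σ ψ₀ τ N n) (MemLp.zero' (p := 2) (μ := volOn a b))
    (ae_norm_sEWIFS_le hab hn) (Eventually.of_forall fun _ => by simpa using hM) (indexSet N)
    (fun r => by
      simp only [h0, sub_zero]
      refine (sum_sq_le_coefNorm_sq r fun l hl =>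
        fourierCoef_sEWIFS_of_notMem hab V β σ ψ₀ τ n hl).trans ?_
      exact pow_le_pow_left₀ (coefNorm_nonneg _ _) (coefNorm_le_of_sum_norm_le hn) 2)
  simpa only [opB_zero, h0, sub_zero] using h

/-- One step of the bootstrap argument: as long as the numerical solution is bounded, the error
estimates hold, with constants that do not depend on the number of steps. -/
theorem IsNLSSolution.error_of_bounded {a b T β σ K M : ℝ} (hab : a < b) (hσ : 0 < σ)
    (hT : 0 < T) (hM : 0 ≤ M) (hKM : K ≤ M) (hK : 0 < K) {V : ℝ → ℝ} (hV : MemLp V ⊤ (volOn a b))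
    {ψ₀ : ℝ → ℂ} {ψ : ℝ → Sobolev a b 2} (hψ : IsNLSSolution a b T V β σ ψ₀ ψ)
    (hbd : ∀ t ∈ Icc 0 T, ∀ s : Finset ℤ,
      ∑ l ∈ s, ‖fourierCoef a b (wderiv (ψ t) 0) l‖ ^ 2 ≤ K ^ 2 ∧
      ∑ l ∈ s, (freq a b l ^ 2 * ‖fourierCoef a b (wderiv (ψ t) 0) l‖) ^ 2 ≤ K ^ 2 ∧
      ∑ l ∈ s, ‖fourierCoef a b (wderiv (ψ t) 0) l‖ ≤ K ∧
      ∀ t' ∈ Icc 0 T, ∑ l ∈ s, ‖fourierCoef a b (wderiv (ψ t) 0) l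
        - fourierCoef a b (wderiv (ψ t') 0) l‖ ^ 2 ≤ (K * |t - t'|) ^ 2) :
    ∃ C : ℝ, 0 < C ∧ ∀ (τ h : ℝ) (N : ℕ), 0 < N → Even N → h = (b - a) / N → 0 < τ → τ ≤ 1 →
      ∀ n : ℕ, n * τ ≤ T →
      (∀ k ≤ n - 1, ∑ l ∈ indexSet N, ‖fourierCoef a b (sEWIFS a b V β σ ψ₀ τ N k) l‖ ≤ M) →
      coefNorm (indexSet N) (fun l => fourierCoef a b (wderiv (ψ (n * τ)) 0) l
        - fourierCoef a b (sEWIFS a b V β σ ψ₀ τ N n) l) ≤ C * (τ + h ^ 2) ∧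
      coefNorm (indexSet N) (fun l => ((freq a b l ^ 2 : ℝ) : ℂ) *
        fourierCoef a b (sEWIFS a b V β σ ψ₀ τ N n) l) ≤ C := by
  set L := lipB a b V β σ M with hLdef
  have hL : 0 ≤ L := lipB_nonneg hσ hM
  -- The Gronwall bounds for the error (`C₁`) and for the `H²` norm (`C₂`), with `n * τ ≤ T` and `τ
  -- ≤ 1` inserted.
  set C₁ := Real.exp (2 * L * T) * (2 * (L * K) * (1 + T)) with hC₁
  set C₂ := Real.exp (2 * L * T) * (K + L * M + 4 * L * (L * M) * T) + L * M with hC₂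
  have hC₁0 : 0 ≤ C₁ := by positivity
  have hC₂0 : 0 < C₂ := by positivity
  refine ⟨C₁ + C₂, by positivity, ?_⟩
  intro τ h N hN hE hh hτ hτ1 n hn hind
  have hb : ∀ t ∈ Icc 0 T, ∀ᵐ x ∂(volOn a b), ‖wderiv (ψ t) 0 x‖ ≤ M := fun t ht =>
    (ae_norm_le_of_sum_le hab (Lp.memLp _) fun s => ((hbd t ht s).2.2.1).trans hKM)
  have hlip := fun t ht t' ht' s => (hbd t ht s).2.2.2 t' ht'
  have hmem : ∀ k : ℕ, k ≤ n → (k : ℝ) * τ ∈ Icc 0 T := fun k hk => by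
    have : (k : ℝ) ≤ n := by exact_mod_cast hk
    exact ⟨by positivity, le_trans (by gcongr) hn⟩
  have hscheme := isSymmetricEWI_sEWIFS hab V β σ ψ₀ τ N
  have h00 : ∀ l ∈ indexSet N, fourierCoef a b (wderiv (ψ ((0 : ℕ) * τ)) 0) l
      = fourierCoef a b (sEWIFS a b V β σ ψ₀ τ N 0) l := fun l hl => by
    rw [fourierCoef_sEWIFS_zero hab V β σ ψ₀ τ hl, fourierCoef_congr_ae hab hψ.initial,
      Nat.cast_zero, zero_mul]
  have hcoef : (1 + 2 * L * τ) ^ n ≤ Real.exp (2 * L * T) :=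
    one_add_pow_le_exp (by positivity) (by
      calc 2 * L * τ * n = 2 * L * (n * τ) := by ring
        _ ≤ 2 * L * T := by gcongr)
  constructor
  · have herr := hscheme.coefNorm_error_le hτ
      (y := fun n => fourierCoef a b (wderiv (ψ (n * τ)) 0))
      (g := fun n => fourierCoef a b (opB V β σ (wderiv (ψ (n * τ)) 0)))
      -- `δ` is the part of `ψ` outside `X_N`, which enters through the nonlinearity; `ρ` is the
      -- variation of the frozen forcing.
      (L := L) (δ := h ^ 2 * K) (ρ := L * K * τ) (n₀ := n) hL (by positivity) (by positivity) h00
      (fun h1n => by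
        have hc := hψ.consistency hab hσ hM hK.le hV hb hlip (indexSet N) (p := (0 : ℕ) * τ)
          (q := (1 : ℕ) * τ) (r := (0 : ℕ) * τ) (τ := τ) (by simp) le_rfl (by simpa using hτ)
          (hmem 1 h1n).2 (by simp [hτ.le]) (by simp)
        refine le_trans (le_of_eq (coefNorm_eq fun l _ => ?_)) hc
        rw [show (((0 : ℕ) * τ - (1 : ℕ) * τ : ℝ)) = -τ by push_cast; ring,
          show (((1 : ℕ) * τ - (0 : ℕ) * τ : ℝ)) = τ by push_cast; ring, sub_self,
          Complex.ofReal_zero, zero_mul, sub_zero, mul_assoc Complex.I (Complex.exp _),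
          exp_mul_phi1])
      (fun k hk => by
        have hc := hψ.consistency hab hσ hM hK.le hV hb hlip (indexSet N) (p := (k : ℕ) * τ)
          (q := (k + 2 : ℕ) * τ) (r := (k + 1 : ℕ) * τ) (τ := τ) (by positivity)
          (by push_cast; nlinarith) (by push_cast; nlinarith)
          (hmem (k + 2) hk).2 (by push_cast; linarith) (by push_cast; linarith)
        refine le_trans (le_of_eq (coefNorm_eq fun l _ => ?_)) hc
        rw [show (((k : ℕ) * τ - (k + 2 : ℕ) * τ : ℝ)) = -(2 * τ) by push_cast; ring,
          show (((k + 1 : ℕ) * τ - (k + 2 : ℕ) * τ : ℝ)) = -τ by push_cast; ring,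
          show (((k + 2 : ℕ) * τ - (k + 1 : ℕ) * τ : ℝ)) = τ by push_cast; ring,
          show (((k : ℕ) * τ - (k + 1 : ℕ) * τ : ℝ)) = -τ by push_cast; ring,
          mul_phi1_sub_mul_phi1_neg]
        ring_nf)
      (fun k hk => by
        refine coefNorm_fourierCoef_opB_sub_le hab hσ hM
          (add_nonneg (coefNorm_nonneg _ _) (by positivity)) hV (Lp.memLp _)
          (memLp_sEWIFS _ _ _ _ _ _ _) (hb _ (hmem k hk.le))
          (ae_norm_sEWIFS_le hab (hind k (by omega))) _ fun r => ?_
        refine (sum_sq_sub_le hab hN hE hh (fun l hl =>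
          fourierCoef_sEWIFS_of_notMem hab V β σ ψ₀ τ k hl)
          (fun s => (hbd _ (hmem k hk.le) s).2.1) r).trans ?_
        have h1 : 0 ≤ coefNorm (indexSet N) (fun l =>
          fourierCoef a b (wderiv (ψ (k * τ)) 0) l
            - fourierCoef a b (sEWIFS a b V β σ ψ₀ τ N k) l) := coefNorm_nonneg _ _
        have h2 : 0 ≤ h ^ 2 * K := by positivity
        nlinarith)
    refine (herr n le_rfl).trans ?_
    calc _ ≤ Real.exp (2 * L * T) * (2 * τ * (L * (h ^ 2 * K) + L * K * τ)
          + 2 * τ * (L * (h ^ 2 * K) + L * K * τ) * n) := by gcongr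
      _ = Real.exp (2 * L * T) * (2 * (L * K) * (τ + n * τ)) * (τ + h ^ 2) := by ring
      _ ≤ C₁ * (τ + h ^ 2) := by rw [hC₁]; gcongr
      _ ≤ (C₁ + C₂) * (τ + h ^ 2) := by gcongr; linarith
  -- Step `n` uses the forcing only up to `n - 1`, so boundedness up to `n - 1` controls the `H²`
  -- norm at `n`; this shift drives the induction.
  · have hst := hscheme.coefNorm_mul_le hτ (L := L) (G₀ := L * M) (b₀ := K) (n₀ := n - 1) hL
      (by positivity) (fun k hk => coefNorm_opB_sEWIFS_le hab hσ hV hM (hind k hk)) (by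
        refine le_of_sq_le_sq ?_ hK.le
        rw [coefNorm_sq]
        refine le_trans (le_of_eq (Finset.sum_congr rfl fun l hl => ?_))
          (hbd _ (hmem 0 (by omega)) (indexSet N)).2.1
        rw [norm_mul, Complex.norm_real, Real.norm_of_nonneg (sq_nonneg _), h00 l hl])
      (fun k hk m hm => coefNorm_opB_sEWIFS_sub_le hab hσ hV hM (hind k hk) (hind m hm))
    refine (hst n (by omega)).trans ?_
    calc _ ≤ Real.exp (2 * L * T) * (K + L * M + 4 * L * (L * M) * τ * n) + L * M := by gcongr
      _ = Real.exp (2 * L * T) * (K + L * M + 4 * L * (L * M) * (n * τ)) + L * M := by ring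
      _ ≤ C₂ := by rw [hC₂]; gcongr
      _ ≤ C₁ + C₂ := by linarith

/-- Error estimates for the Fourier coefficients. -/
theorem IsNLSSolution.exists_fourierCoef_error_le {a b T β σ : ℝ} (hab : a < b) (hσ : 0 < σ)
    (hT : 0 < T) {V : ℝ → ℝ} (hV : MemLp V ⊤ (volOn a b)) {ψ₀ : ℝ → ℂ} {ψ : ℝ → Sobolev a b 2}
    (hψ : IsNLSSolution a b T V β σ ψ₀ ψ) :
    ∃ η > 0, ∃ C > 0, ∀ (τ h : ℝ) (N : ℕ), 0 < N → Even N → h = (b - a) / N → 0 < τ → τ < η →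
      h < η → ∀ n : ℕ, n * τ ≤ T → τ + h ^ 2 ≤ 1 ∧
      (∀ r : Finset ℤ, ∑ l ∈ r, ‖fourierCoef a b (wderiv (ψ (n * τ)) 0) l
        - fourierCoef a b (sEWIFS a b V β σ ψ₀ τ N n) l‖ ^ 2 ≤ (C * (τ + h ^ 2)) ^ 2) ∧
      (∀ r : Finset ℤ, ∑ l ∈ r, freq a b l ^ 2 * ‖fourierCoef a b (wderiv (ψ (n * τ)) 0) l
        - fourierCoef a b (sEWIFS a b V β σ ψ₀ τ N n) l‖ ^ 2 ≤ C ^ 2 * (τ + h ^ 2)) ∧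
      (∀ r : Finset ℤ, ∑ l ∈ r, ‖fourierCoef a b (sEWIFS a b V β σ ψ₀ τ N n) l‖ ^ 2 ≤ C ^ 2) ∧
      (∀ r : Finset ℤ, ∑ l ∈ r,
        (freq a b l ^ 2 * ‖fourierCoef a b (sEWIFS a b V β σ ψ₀ τ N n) l‖) ^ 2 ≤ C ^ 2) := by
  obtain ⟨K, hK, hbd⟩ := hψ.exists_bound hab
  obtain ⟨C₀, hC₀, herr⟩ := hψ.error_of_bounded (M := K + 1) hab hσ hT (by positivity) (by linarith)
    hK hV hbd
  obtain ⟨S, hS0, hS⟩ := exists_sum_inv_one_add_freq_sq_le hab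
  set C := C₀ + 2 * K + 1 with hC
  have hC0 : 0 < C := by positivity
  -- Chosen so that the embedding bound `2 * S * C ^ 2 * ε`, with `ε ≤ 2 * η`, is at most `1`, the
  -- margin between `K` and `K + 1`.
  set η := min (1 / 2) (1 / (4 * S * C ^ 2)) with hη
  have hη0 : 0 < η := lt_min (by norm_num) (by positivity)
  have hη1 : η ≤ 1 / 2 := min_le_left _ _
  have hη2 : 4 * S * C ^ 2 * η ≤ 1 := by
    have := min_le_right (1 / 2) (1 / (4 * S * C ^ 2))
    rw [le_div_iff₀ (by positivity)] at this
    linarith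
  refine ⟨η, hη0, C, hC0, ?_⟩
  intro τ h N hN hE hh hτ hτη hhη n hn
  have hNpos : (0 : ℝ) < N := by exact_mod_cast hN
  have hh0 : 0 < h := by rw [hh]; exact div_pos (sub_pos.2 hab) hNpos
  have hh2 : h ^ 2 ≤ η := by nlinarith
  set ε := τ + h ^ 2 with hε
  have hε0 : 0 < ε := by positivity
  have hε1 : ε ≤ 1 := by linarith
  have hεη : ε ≤ 2 * η := by linarith
  set u := fun n => fourierCoef a b (sEWIFS a b V β σ ψ₀ τ N n) with hu
  set y := fun n : ℕ => fourierCoef a b (wderiv (ψ (n * τ)) 0) with hy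
  have hoff : ∀ n, ∀ l ∉ indexSet N, u n l = 0 := fun n l hl =>
    fourierCoef_sEWIFS_of_notMem hab V β σ ψ₀ τ n hl
  have hmem : ∀ k : ℕ, k ≤ n → (k : ℝ) * τ ∈ Icc 0 T := fun k hk => by
    have : (k : ℝ) ≤ n := by exact_mod_cast hk
    exact ⟨by positivity, le_trans (by gcongr) hn⟩
  have hmain : ∀ k ≤ n, (∀ j ≤ k - 1, ∑ l ∈ indexSet N, ‖u j l‖ ≤ K + 1) →
      (∀ r : Finset ℤ, ∑ l ∈ r, ‖y k l - u k l‖ ^ 2 ≤ (C * ε) ^ 2) ∧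
      (∀ r : Finset ℤ, ∑ l ∈ r, freq a b l ^ 2 * ‖y k l - u k l‖ ^ 2 ≤ C ^ 2 * ε) ∧
      (∀ r : Finset ℤ, ∑ l ∈ r, (freq a b l ^ 2 * ‖u k l‖) ^ 2 ≤ C ^ 2) := by
    intro k hk hind
    obtain ⟨e1, e2⟩ := herr τ h N hN hE hh hτ (by linarith) k (hmem k hk).2 hind
    have hnn := coefNorm_nonneg (indexSet N) (fun l => y k l - u k l)
    have g1 : ∀ r : Finset ℤ, ∑ l ∈ r, ‖y k l - u k l‖ ^ 2 ≤ (C * ε) ^ 2 := fun r => by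
      refine (sum_sq_sub_le hab hN hE hh (hoff k) (fun s => (hbd _ (hmem k hk) s).2.1) r).trans ?_
      have h2 : 0 ≤ h ^ 2 * K := by positivity
      have h3 : h ^ 2 * K ≤ ε * K := by gcongr; linarith
      have h4 : coefNorm (indexSet N) (fun l => y k l - u k l) + h ^ 2 * K ≤ C * ε := by
        calc _ ≤ C₀ * ε + ε * K := add_le_add e1 h3
          _ ≤ C * ε := by rw [hC]; nlinarith
      calc _ ≤ (coefNorm (indexSet N) (fun l => y k l - u k l) + h ^ 2 * K) ^ 2 := by nlinarith
        _ ≤ _ := pow_le_pow_left₀ (by positivity) h4 2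
    have hw : ∀ (c : ℤ → ℂ) (r : Finset ℤ), ∑ l ∈ r, (freq a b l ^ 2 * ‖c l‖) ^ 2
        = coefNorm r (fun l => ((freq a b l ^ 2 : ℝ) : ℂ) * c l) ^ 2 := fun c r => by
      rw [coefNorm_sq]
      refine Finset.sum_congr rfl fun l _ => ?_
      rw [norm_mul, Complex.norm_real, Real.norm_of_nonneg (sq_nonneg _)]
    have g2 : ∀ r : Finset ℤ, coefNorm r (fun l => ((freq a b l ^ 2 : ℝ) : ℂ) * u k l) ≤ C₀ :=
      fun r => by
        refine le_of_sq_le_sq ?_ hC₀.le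
        rw [coefNorm_sq]
        refine (sum_sq_le_coefNorm_sq (s := indexSet N) r fun l hl => by
          rw [hoff k l hl, mul_zero]).trans ?_
        exact pow_le_pow_left₀ (coefNorm_nonneg _ _) e2 2
    have g3 : ∀ r : Finset ℤ, ∑ l ∈ r, (freq a b l ^ 2 * ‖y k l - u k l‖) ^ 2 ≤ C ^ 2 := fun r => by
      rw [hw (fun l => y k l - u k l)]
      refine pow_le_pow_left₀ (coefNorm_nonneg _ _) ?_ 2
      have h1 := coefNorm_sub_le r (fun l => ((freq a b l ^ 2 : ℝ) : ℂ) * y k l)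
        (fun l => ((freq a b l ^ 2 : ℝ) : ℂ) * u k l)
      have h2 : coefNorm r (fun l => ((freq a b l ^ 2 : ℝ) : ℂ) * y k l) ≤ K := by
        refine le_of_sq_le_sq ?_ hK.le
        rw [← hw]
        exact (hbd _ (hmem k hk) r).2.1
      have h3 := g2 r
      simp only [mul_sub]
      linarith
    refine ⟨g1, fun r => sum_freq_sq_mul_le hε0 (g1 r) (g3 r), fun r => ?_⟩
    rw [hw]
    exact pow_le_pow_left₀ (coefNorm_nonneg _ _) ((g2 r).trans (by linarith)) 2
  -- Closing the bootstrap: the `L²` and `H¹` errors bound the absolute sum of the error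
  -- coefficients by `1`, which restores the assumed bound at step `k`.
  have hsum : ∀ k ≤ n, (∀ r : Finset ℤ, ∑ l ∈ r, ‖y k l - u k l‖ ^ 2 ≤ (C * ε) ^ 2) →
      (∀ r : Finset ℤ, ∑ l ∈ r, freq a b l ^ 2 * ‖y k l - u k l‖ ^ 2 ≤ C ^ 2 * ε) →
      ∑ l ∈ indexSet N, ‖u k l‖ ≤ K + 1 := by
    intro k hk g1 g2
    have h1 : ∑ l ∈ indexSet N, ‖y k l - u k l‖ ≤ 1 := by
      refine le_of_sq_le_sq ((sum_norm_sq_le hS _ _).trans ?_) zero_le_one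
      simp only [add_mul, one_mul, Finset.sum_add_distrib]
      have h2 := g1 (indexSet N)
      have h3 := g2 (indexSet N)
      have h4 : (C * ε) ^ 2 ≤ C ^ 2 * ε := by
        rw [mul_pow]; gcongr; nlinarith
      calc _ ≤ S * (C ^ 2 * ε + C ^ 2 * ε) := by gcongr; linarith
        _ = 2 * S * C ^ 2 * ε := by ring
        _ ≤ 2 * S * C ^ 2 * (2 * η) := by gcongr
        _ = 4 * S * C ^ 2 * η := by ring
        _ ≤ 1 ^ 2 := by rw [one_pow]; exact hη2
    have h2 : ∑ l ∈ indexSet N, ‖y k l‖ ≤ K := (hbd _ (hmem k hk) (indexSet N)).2.2.1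
    have h3 : ∑ l ∈ indexSet N, ‖u k l‖
        ≤ ∑ l ∈ indexSet N, (‖y k l‖ + ‖y k l - u k l‖) :=
      Finset.sum_le_sum fun l _ => norm_le_norm_add_norm_sub (y k l) (u k l)
    rw [Finset.sum_add_distrib] at h3
    linarith
  have hP0 : ∑ l ∈ indexSet N, ‖u 0 l‖ ≤ K + 1 := by
    have h1 := (hbd 0 ⟨le_rfl, hT.le⟩ (indexSet N)).2.2.1
    refine le_trans (le_of_eq (Finset.sum_congr rfl fun l hl => ?_)) (h1.trans (by linarith))
    rw [hu]
    simp only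
    rw [fourierCoef_sEWIFS_zero hab V β σ ψ₀ τ hl, fourierCoef_congr_ae hab hψ.initial]
  have hP : ∀ k ≤ n, ∑ l ∈ indexSet N, ‖u k l‖ ≤ K + 1 := by
    intro k
    induction k using Nat.strong_induction_on with
    | _ k ih =>
      intro hk
      rcases Nat.eq_zero_or_pos k with rfl | hpos
      · exact hP0
      · obtain ⟨g1, g2, -⟩ := hmain k hk fun j hj => ih j (by omega) (by omega)
        exact hsum k hk g1 g2
  obtain ⟨g1, g2, g3⟩ := hmain n le_rfl fun j hj => hP j (by omega)
  refine ⟨hε1, g1, g2, fun r => ?_, g3⟩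
  refine (sum_sq_le_coefNorm_sq r (hoff n)).trans (pow_le_pow_left₀ (coefNorm_nonneg _ _) ?_ 2)
  exact (coefNorm_le_of_sum_norm_le (hP n le_rfl)).trans (by linarith)

/-! ### From coefficient sums back to `L²` and Sobolev norms -/

theorem eLpNorm_le_of_sum_sq_le {a b B : ℝ} (hab : a < b) {f : ℝ → ℂ} (hf : MemLp f 2 (volOn a b))
    (hB : 0 ≤ B) (h : ∀ r : Finset ℤ, ∑ l ∈ r, ‖fourierCoef a b f l‖ ^ 2 ≤ B ^ 2) :
    eLpNorm f 2 (volOn a b) ≤ ENNReal.ofReal (Real.sqrt (b - a) * B) := by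
  have hba : 0 < b - a := sub_pos.2 hab
  have h1 := hasSum_le_of_sum_le (hasSum_sq_fourierCoef hab hf) h
  rw [inv_mul_le_iff₀ hba] at h1
  have h2 := hf.eLpNorm_eq_integral_rpow_norm (by norm_num) (by norm_num)
  simp only [ENNReal.toReal_ofNat, Real.rpow_ofNat] at h2
  rw [h2, ← one_div, ← Real.sqrt_eq_rpow]
  refine ENNReal.ofReal_le_ofReal ?_
  rw [← Real.sqrt_sq hB, ← Real.sqrt_mul hba.le]
  exact Real.sqrt_le_sqrt h1

theorem norm_L2_sq_le_of_sum_sq_le {a b B : ℝ} (hab : a < b) (f : L2 a b)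
    (h : ∀ r : Finset ℤ, ∑ l ∈ r, ‖fourierCoef a b f l‖ ^ 2 ≤ B ^ 2) :
    ‖f‖ ^ 2 ≤ (b - a) * B ^ 2 := by
  have h1 := hasSum_le_of_sum_le (hasSum_sq_fourierCoef_L2 hab f) h
  rwa [inv_mul_le_iff₀ (sub_pos.2 hab)] at h1

theorem sobolevNorm_le_of_sum_sq_le {a b B : ℝ} (hab : a < b) {m : ℕ} {u : ℝ → ℂ}
    (w : Sobolev a b m) (hu : u =ᵐ[volOn a b] wderiv w 0) (hB : 0 ≤ B)
    (h : ∀ k, ∀ r : Finset ℤ, ∑ l ∈ r, ‖fourierCoef a b (wderiv w k) l‖ ^ 2 ≤ B ^ 2) :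
    sobolevNorm a b m u ≤ ENNReal.ofReal (Real.sqrt ((m + 1) * (b - a)) * B) := by
  have hba : 0 < b - a := sub_pos.2 hab
  refine (iInf₂_le w hu).trans ?_
  rw [← ofReal_norm]
  refine ENNReal.ofReal_le_ofReal (le_of_sq_le_sq ?_ (by positivity))
  rw [mul_pow, Real.sq_sqrt (by positivity)]
  have h1 : ‖w‖ ^ 2 = ∑ k, ‖wderiv w k‖ ^ 2 :=
    PiLp.norm_sq_eq_of_L2 _ (w : PiLp 2 (fun _ : Fin (m + 1) => L2 a b))
  rw [h1]
  refine (Finset.sum_le_sum fun k _ => norm_L2_sq_le_of_sum_sq_le hab _ (h k)).trans (le_of_eq ?_)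
  rw [Finset.sum_const, Finset.card_univ, Fintype.card_fin, nsmul_eq_mul]
  push_cast
  ring

theorem isWeakDeriv_congr_ae {a b : ℝ} {u u' v v' : ℝ → ℂ} (h : IsWeakDeriv a b u v)
    (hu : u =ᵐ[volOn a b] u') (hv : v =ᵐ[volOn a b] v') : IsWeakDeriv a b u' v' := by
  intro φ h1 h2 h3
  have e1 : ∫ x in Ioo a b, deriv φ x • u' x = ∫ x in Ioo a b, deriv φ x • u x :=
    integral_congr_ae (by filter_upwards [hu] with x hx; rw [hx])
  have e2 : ∫ x in Ioo a b, φ x • v' x = ∫ x in Ioo a b, φ x • v x :=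
    integral_congr_ae (by filter_upwards [hv] with x hx; rw [hx])
  rw [e1, e2]
  exact h φ h1 h2 h3

theorem hasDerivAt_trigPoly (a b : ℝ) (N : ℕ) (c : ℤ → ℂ) (x : ℝ) :
    HasDerivAt (trigPoly a b N c)
      (trigPoly a b N (fun l => Complex.I * freq a b l * c l) x) x := by
  have h : ∀ l : ℤ, HasDerivAt (fun x : ℝ => c l * Complex.exp (Complex.I * freq a b l * (x - a)))
      (Complex.I * freq a b l * c l * Complex.exp (Complex.I * freq a b l * (x - a))) x := by
    intro l
    have h1 : HasDerivAt (fun x : ℝ => Complex.I * freq a b l * ((x : ℂ) - a))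
        (Complex.I * freq a b l * ((1 : ℝ) : ℂ)) x :=
      (((hasDerivAt_id' x).ofReal_comp).sub_const (a : ℂ)).const_mul _
    refine (h1.cexp.const_mul (c l)).congr_deriv ?_
    rw [Complex.ofReal_one]
    ring
  exact HasDerivAt.fun_sum fun l _ => h l

/-- A trigonometric polynomial as an element of `H^m`. -/
noncomputable def trigSobolev (a b : ℝ) (hab : a < b) (N : ℕ) (c : ℤ → ℂ) (m : ℕ) : Sobolev a b m :=
  ⟨WithLp.toLp 2 fun k : Fin (m + 1) =>
    (memLp_trigPoly a b N (fun l => (Complex.I * freq a b l) ^ (k : ℕ) * c l)).toLp _, fun k => by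
    refine isWeakDeriv_congr_ae (isWeakDeriv_of_hasDerivAt hab
      (hasDerivAt_trigPoly a b N (fun l => (Complex.I * freq a b l) ^ (k : ℕ) * c l))
      (continuous_trigPoly _ _ _ _))
      (memLp_trigPoly a b N (fun l => (Complex.I * freq a b l) ^ (k : ℕ) * c l)).coeFn_toLp.symm ?_
    refine EventuallyEq.trans (EventuallyEq.of_eq (trigPoly_congr fun l _ => ?_))
      (memLp_trigPoly a b N
        (fun l => (Complex.I * freq a b l) ^ (k.succ : ℕ) * c l)).coeFn_toLp.symm
    rw [Fin.val_succ, pow_succ']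
    ring⟩

theorem wderiv_trigSobolev_ae_eq {a b : ℝ} (hab : a < b) (N : ℕ) (c : ℤ → ℂ) (m : ℕ)
    (k : Fin (m + 1)) : wderiv (trigSobolev a b hab N c m) k
      =ᵐ[volOn a b] trigPoly a b N (fun l => (Complex.I * freq a b l) ^ (k : ℕ) * c l) :=
  (memLp_trigPoly a b N (fun l => (Complex.I * freq a b l) ^ (k : ℕ) * c l)).coeFn_toLp

theorem fourierCoef_wderiv_trigSobolev {a b : ℝ} (hab : a < b) (N : ℕ) (c : ℤ → ℂ) (m : ℕ)
    (k : Fin (m + 1)) (l : ℤ) : fourierCoef a b (wderiv (trigSobolev a b hab N c m) k) l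
      = if l ∈ indexSet N then (Complex.I * freq a b l) ^ (k : ℕ) * c l else 0 := by
  rw [fourierCoef_congr_ae hab (wderiv_trigSobolev_ae_eq hab N c m k), fourierCoef_trigPoly hab]

/-- The embedding of `H^{m+1}` into `H^m`. -/
noncomputable def Sobolev.truncate {a b : ℝ} {m : ℕ} (w : Sobolev a b (m + 1)) : Sobolev a b m :=
  ⟨WithLp.toLp 2 fun k : Fin (m + 1) => wderiv w k.castSucc, fun k => w.2 k.castSucc⟩

theorem wderiv_sub {a b : ℝ} {m : ℕ} (v w : Sobolev a b m) (k : Fin (m + 1)) :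
    wderiv (v - w) k = wderiv v k - wderiv w k := rfl

theorem theorem4p2 (a b T β σ : ℝ) (hab : a < b) (hT : 0 < T) (hσ : 0 < σ)
    (V : ℝ → ℝ) (hV : MemLp V ∞ (volOn a b))
    (ψ₀ : ℝ → ℂ) (ψ : ℝ → Sobolev a b 2) (hψ : IsNLSSolution a b T V β σ ψ₀ ψ) :
    ∃ τ₀ > 0, ∃ h₀ > 0, ∃ C > 0, ∀ (τ h : ℝ) (N : ℕ),
      0 < N → Even N → h = (b - a) / N → 0 < τ → τ < τ₀ → h < h₀ →
      ∀ n : ℕ, (n : ℝ) ≤ T / τ →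
        eLpNorm (fun x => wderiv (ψ (n * τ)) 0 x - sEWIFS a b V β σ ψ₀ τ N n x) 2 (volOn a b)
            ≤ ENNReal.ofReal (C * (τ + h ^ 2)) ∧
        sobolevNorm a b 2 (sEWIFS a b V β σ ψ₀ τ N n) ≤ ENNReal.ofReal C ∧
        sobolevNorm a b 1 (fun x => wderiv (ψ (n * τ)) 0 x - sEWIFS a b V β σ ψ₀ τ N n x)
            ≤ ENNReal.ofReal (C * (τ ^ (1 / 2 : ℝ) + h)) := by
  obtain ⟨η, hη, C, hC, H⟩ := hψ.exists_fourierCoef_error_le hab hσ hT hV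
  have hba : 0 < b - a := sub_pos.2 hab
  -- The conversion factor for the three components of `H²`; `2 * Q` also dominates the factors for
  -- `L²` and `H¹`.
  set Q := Real.sqrt (3 * (b - a)) with hQ
  have hQ0 : 0 < Q := Real.sqrt_pos.2 (by positivity)
  have hQ1 : Real.sqrt (b - a) ≤ 2 * Q :=
    (Real.sqrt_le_sqrt (by linarith : b - a ≤ 3 * (b - a))).trans (by linarith)
  have hQ2 : Real.sqrt ((1 + 1) * (b - a)) ≤ 2 * Q :=
    (Real.sqrt_le_sqrt (by linarith : (1 + 1) * (b - a) ≤ 3 * (b - a))).trans (by linarith)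
  refine ⟨η, hη, η, hη, 2 * Q * C, by positivity, ?_⟩
  intro τ h N hN hE hh hτ hτη hhη n hn
  have hNpos : (0 : ℝ) < N := by exact_mod_cast hN
  have hh0 : 0 < h := by rw [hh]; exact div_pos hba hNpos
  have hnT : n * τ ≤ T := (le_div_iff₀ hτ).1 hn
  obtain ⟨hε1, g1, g2, g3, g4⟩ := H τ h N hN hE hh hτ hτη hhη n hnT
  have ht : (n : ℝ) * τ ∈ Icc 0 T := ⟨by positivity, hnT⟩
  set U := sEWIFS a b V β σ ψ₀ τ N n with hU
  have hUmem : MemLp U 2 (volOn a b) := memLp_sEWIFS V β σ ψ₀ τ N n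
  have hUtrig : U = trigPoly a b N (fourierCoef a b U) := sEWIFS_eq_trigPoly hab V β σ ψ₀ τ N n
  have hUoff : ∀ l ∉ indexSet N, fourierCoef a b U l = 0 := fun l hl =>
    fourierCoef_sEWIFS_of_notMem hab V β σ ψ₀ τ n hl
  have hUw : ∀ m, U =ᵐ[volOn a b] wderiv (trigSobolev a b hab N (fourierCoef a b U) m) 0 := fun m =>
    ((wderiv_trigSobolev_ae_eq hab N (fourierCoef a b U) m 0).trans (EventuallyEq.of_eq (by
      simp only [Fin.val_zero, pow_zero, one_mul]
      exact hUtrig.symm))).symm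
  have hUk : ∀ m (k : Fin (m + 1)) l,
      fourierCoef a b (wderiv (trigSobolev a b hab N (fourierCoef a b U) m) k) l
        = (Complex.I * freq a b l) ^ (k : ℕ) * fourierCoef a b U l := fun m k l => by
    rw [fourierCoef_wderiv_trigSobolev]
    split_ifs with hl
    · rfl
    · rw [hUoff l hl, mul_zero]
  have hnI : ∀ l, ‖Complex.I * (freq a b l : ℂ)‖ = |freq a b l| := fun l => by
    rw [norm_mul, Complex.norm_I, one_mul, Complex.norm_real, Real.norm_eq_abs]
  refine ⟨?_, ?_, ?_⟩
  · refine (eLpNorm_le_of_sum_sq_le hab ((Lp.memLp _).sub hUmem)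
      (B := C * (τ + h ^ 2)) (by positivity) fun r => ?_).trans ?_
    · refine le_trans (le_of_eq (Finset.sum_congr rfl fun l _ => ?_)) (g1 r)
      exact congrArg (‖·‖ ^ 2) (fourierCoef_sub hab (Lp.memLp _) hUmem l)
    · refine ENNReal.ofReal_le_ofReal ?_
      rw [mul_assoc _ C]
      exact mul_le_mul_of_nonneg_right hQ1 (by positivity)
  · refine (sobolevNorm_le_of_sum_sq_le hab _ (hUw 2) (B := 2 * C) (by positivity)
      fun k r => ?_).trans (ENNReal.ofReal_le_ofReal (le_of_eq ?_))
    · have hle : ∀ l ∈ r,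
          ‖fourierCoef a b (wderiv (trigSobolev a b hab N (fourierCoef a b U) 2) k) l‖ ^ 2
            ≤ ‖fourierCoef a b U l‖ ^ 2 + (freq a b l ^ 2 * ‖fourierCoef a b U l‖) ^ 2 := by
        intro l _
        rw [hUk, norm_mul, norm_pow, hnI, mul_pow, mul_pow, ← pow_mul, mul_comm (k : ℕ) 2, pow_mul,
          sq_abs]
        have hsq := sq_nonneg (freq a b l)
        have hu := sq_nonneg ‖fourierCoef a b U l‖
        -- All three derivatives are controlled by the extreme ones, since `x ^ k ≤ 1 + x ^ 2` for
        -- `x ≥ 0` and `k ≤ 2`.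
        have hk : (freq a b l ^ 2) ^ (k : ℕ) ≤ 1 + (freq a b l ^ 2) ^ 2 := by
          fin_cases k
          · simp; positivity
          · simp only [pow_one]; nlinarith
          · simp
        calc _ ≤ (1 + (freq a b l ^ 2) ^ 2) * ‖fourierCoef a b U l‖ ^ 2 := by gcongr
          _ = _ := by ring
      refine (Finset.sum_le_sum hle).trans ?_
      rw [Finset.sum_add_distrib]
      have := g3 r
      have := g4 r
      nlinarith
    · push_cast
      rw [hQ]
      norm_num
      ring
  -- An explicit `H¹` representative of the error; any representative bounds the infimum in
  -- `sobolevNorm`.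
  · set v := Sobolev.truncate (ψ (n * τ)) - trigSobolev a b hab N (fourierCoef a b U) 1 with hv
    have hv0 : (fun x => wderiv (ψ (n * τ)) 0 x - U x) =ᵐ[volOn a b] wderiv v 0 := by
      have h1 := Lp.coeFn_sub (wderiv (Sobolev.truncate (ψ (n * τ))) 0)
        (wderiv (trigSobolev a b hab N (fourierCoef a b U) 1) 0)
      rw [hv, wderiv_sub]
      filter_upwards [h1, hUw 1] with x hx1 hx2
      rw [hx1, Pi.sub_apply, ← hx2]
      rfl
    have hvk : ∀ (k : Fin 2) l, ‖fourierCoef a b (wderiv v k) l‖ ^ 2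
        = (freq a b l ^ 2) ^ (k : ℕ)
          * ‖fourierCoef a b (wderiv (ψ (n * τ)) 0) l - fourierCoef a b U l‖ ^ 2 := by
      intro k l
      have h1 : fourierCoef a b (wderiv (Sobolev.truncate (ψ (n * τ))) k) l
          = (Complex.I * freq a b l) ^ (k : ℕ) * fourierCoef a b (wderiv (ψ (n * τ)) 0) l := by
        fin_cases k
        · simp only [Fin.zero_eta, pow_zero, one_mul]; rfl
        · simp only [Fin.mk_one, pow_one]
          exact (hψ.periodic _ ht).fourierCoef_wderiv_one hab l
      rw [hv, wderiv_sub, fourierCoef_L2_sub hab, hUk, h1, ← mul_sub, norm_mul, norm_pow, hnI,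
        mul_pow, ← pow_mul, mul_comm (k : ℕ) 2, pow_mul, sq_abs]
    have hsq : Real.sqrt (τ + h ^ 2) ≤ τ ^ (1 / 2 : ℝ) + h := by
      rw [← Real.sqrt_eq_rpow]
      refine Real.sqrt_le_iff.2 ⟨by positivity, ?_⟩
      have h1 := Real.sq_sqrt hτ.le
      have h2 := mul_nonneg (Real.sqrt_nonneg τ) hh0.le
      nlinarith
    refine (sobolevNorm_le_of_sum_sq_le hab v hv0 (B := C * Real.sqrt (τ + h ^ 2)) (by positivity)
      fun k r => ?_).trans (ENNReal.ofReal_le_ofReal ?_)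
    · simp only [hvk]
      rw [mul_pow, Real.sq_sqrt (by positivity)]
      fin_cases k
      · simp only [pow_zero, one_mul]
        refine (g1 r).trans ?_
        rw [mul_pow]
        have : 0 ≤ τ + h ^ 2 := by positivity
        gcongr
        nlinarith
      · simp only [pow_one]
        exact g2 r
    · rw [Nat.cast_one, mul_assoc (2 * Q)]
      gcongr
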